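/- **Setting.** Let $a>0$, $\Omega_0=(-a,a)^2\subset\mathbb R^2$, and let $g,\sigma$ be real functions with compact supports contained in $\Omega_0$, $g\in L^2(\Omega_0)$, $\sigma\in L^4(\Omega_0)$, $\sigma\ge 0$. Let $\dot W$ be white noise on $\mathbb R^2$, and for $k>0$ let $G_k(x,y)=-\frac{\mathrm i}{4}H_0^{(1)}(k|x-y|)$, $H_0^{(1)}=J_0+\mathrm iY_0$. Let $u=u(\cdot,k)$ be the mild solution of the Helmholtz equation $\Delta u+k^2u=g+\sigma\dot W$ with the Sommerfeld radiation condition, i.e. the continuous process with $$u(x,k)=\int_{\Omega_0}G_k(x,y)g(y)\,\mathrm dy+\int_{\Omega_0}G_k(x,y)\sigma(y)\,\mathrm dW_y .$$ Let $k^*=\frac{\pi}{30a}$, let $k\in\{\frac{\pi}{a}x:\ x\ge1\}\cup\{k^*\}$, and let $m\ge10$ be an integer, $\tau\ge6$, $\lambda_1=\frac12$, and $$R=\tau a,\quad \lambda_2=\tfrac12+\tfrac{\pi}{2kR}\quad\text{if }k\ne k^*;\qquad R=6a,\quad\lambda_2=-\tfrac32\quad\text{if }k=k^*.$$ Put $\nu_\mu=\mu\pi/m$.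 For $j=1,\dots,m$ let $\partial B_j=\{R(\cos\theta,\sin\theta):\nu_{2j-2}\le\theta\le\nu_{2j}\}$, $z_{j,\ell}=\lambda_\ell R(\cos\nu_{2j-1},\sin\nu_{2j-1})$ and $r_{j,\ell}(x)=|x-z_{j,\ell}|$ for $\ell=1,2$, and let $\|\cdot\|_{j,\infty}$ be the norm of $L^\infty(\partial B_j)$ (with respect to arc length). Write $u_{j,k}=u(\cdot,k)|_{\partial B_j}$. **Data.** Let $0<\varepsilon<1$. The measured data are real functions on $\partial B_j$, denoted by $|\mathbf E^\varepsilon(u_{j,k})|\ge 0$, $|\mathbf E^\varepsilon(v_{j,\ell,k})|\ge 0$ ($\ell=1,2$) and $\mathbf E^\varepsilon(|u_{j,k}|^2)$. Put $$c^\varepsilon_{j,\ell,k}=\frac{\big\||\mathbf E^\varepsilon(u_{j,k})|\big\|_{j,\infty}}{\|G_k(\cdot,z_{j,\ell})\|_{j,\infty}},\qquad \hat v_{j,\ell,k}=u_{j,k}+c^\varepsilon_{j,\ell,k}G_k(\cdot,z_{j,\ell}),$$ and assume that, for $\ell=1,2$, $$\big\||\mathbf E^\varepsilon(u_{j,k})|-|\mathbf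 E(u_{j,k})|\big\|_{j,\infty}\le\varepsilon\|\mathbf E(u_{j,k})\|_{j,\infty},\qquad \big\||\mathbf E^\varepsilon(v_{j,\ell,k})|-|\mathbf E(\hat v_{j,\ell,k})|\big\|_{j,\infty}\le\varepsilon\|\mathbf E(\hat v_{j,\ell,k})\|_{j,\infty},$$ $$\|\mathbf E^\varepsilon(|u_{j,k}|^2)-\mathbf E(|u_{j,k}|^2)\|_{j,\infty}\le\varepsilon\|\mathbf E(|u_{j,k}|^2)\|_{j,\infty}.$$ **Recovered mean.** Put $$f^\varepsilon_{j,\ell,k}=\frac{2}{c^\varepsilon_{j,\ell,k}}\Big(|\mathbf E^\varepsilon(v_{j,\ell,k})|^2-|\mathbf E^\varepsilon(u_{j,k})|^2\Big)-\frac{c^\varepsilon_{j,\ell,k}}{8}\big|H_0^{(1)}(kr_{j,\ell})\big|^2$$ (with the convention that the first term is $0$ in the degenerate case $c^\varepsilon_{j,\ell,k}=0$, which occurs only if $\mathbf E(u_{j,k})=0$ almost everywhere on $\partial B_j$). The recovered mean is the complex function $\mathbf E^\varepsilon(u_{j,k})=\mathbf E^\varepsilon(\operatorname{Re}u_{j,k})+\mathrm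 i\,\mathbf E^\varepsilon(\operatorname{Im}u_{j,k})$ on $\partial B_j$ whose real and imaginary parts solve, at each point, the linear system $$Y_0(kr_{j,\ell})\,\mathbf E^\varepsilon(\operatorname{Re}u_{j,k})-J_0(kr_{j,\ell})\,\mathbf E^\varepsilon(\operatorname{Im}u_{j,k})=f^\varepsilon_{j,\ell,k},\qquad \ell=1,2,$$ and are given by Cramer's rule. (Its modulus need not equal the measured datum $|\mathbf E^\varepsilon(u_{j,k})|$.) **Theorem.** For every $j=1,\dots,m$, the determinant of this system does not vanish at any point of $\partial B_j$, so that the recovered mean is well defined, and $$\|\mathbf E^\varepsilon(u_{j,k})-\mathbf E(u_{j,k})\|_{j,\infty}\le\varepsilon\,C_\varepsilon\,\|\mathbf E(u_{j,k})\|_{j,\infty},\qquad C_\varepsilon=\frac{2.5(2+\varepsilon)^2(3+\varepsilon)+20}{1-\varepsilon}.$$ -/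

import Mathlib

open MeasureTheory ProbabilityTheory
open scoped ENNReal NNReal

noncomputable section

namespace PhaseRetrieval

/-- The Euclidean plane. -/
abbrev Plane : Type := EuclideanSpace ℝ (Fin 2)

/-! ### Bessel functions of order zero and the Green's function -/

/-- Bessel function of the first kind of order zero (power series). -/
def besselJ0 (t : ℝ) : ℝ :=
  ∑' p : ℕ, (-1 : ℝ) ^ p / (p.factorial : ℝ) ^ 2 * (t / 2) ^ (2 * p)

/-- Bessel function of the second kind of order zero, for `t > 0`.  The term `p = 0` of the
series vanishes because `harmonic 0 = 0`. -/
def besselY0 (t : ℝ) : ℝ :=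
  2 / Real.pi * (Real.log (t / 2) + Real.eulerMascheroniConstant) * besselJ0 t
    - 2 / Real.pi *
      ∑' p : ℕ, (-1 : ℝ) ^ p * ((harmonic p : ℚ) : ℝ) / (p.factorial : ℝ) ^ 2 * (t / 2) ^ (2 * p)

/-- Hankel function of the first kind of order zero, for `t > 0`. -/
def hankel0 (t : ℝ) : ℂ := (besselJ0 t : ℂ) + Complex.I * (besselY0 t : ℂ)

/-- Outgoing Green's function of the Helmholtz operator `Δ + k²` in the plane. -/
def green (k : ℝ) (x y : Plane) : ℂ := -(Complex.I / 4) * hankel0 (k * ‖x - y‖)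

/-! ### The random source and the radiated field -/

/-- The square `(-a, a)²`. -/
def square (a : ℝ) : Set Plane := {x | ∀ i, x i ∈ Set.Ioo (-a) a}

/-- White noise on the plane: the centred isonormal Gaussian process over `L²(ℝ²)`, that is a linear
map `h ↦ ∫ h dW` into `L²(P)` with `∫ h dW` of law `N(0, ‖h‖²)` for each `h`. -/
def IsWhiteNoise {Ω : Type*} [MeasurableSpace Ω] (P : Measure Ω)
    (W : Lp ℝ 2 (volume : Measure Plane) →ₗ[ℝ] Lp ℝ 2 P) : Prop :=
  ∀ h, HasLaw (W h : Ω → ℝ) (gaussianReal 0 (‖h‖₊ ^ 2)) P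

open Classical in
/-- The stochastic integral `∫_D h(y) dW_y` of a real function that is square integrable over `D`
(and `0` by convention for other `h`). -/
def wienerIntegral {Ω : Type*} [MeasurableSpace Ω] {P : Measure Ω}
    (W : Lp ℝ 2 (volume : Measure Plane) →ₗ[ℝ] Lp ℝ 2 P)
    (D : Set Plane) (h : Plane → ℝ) : Ω → ℝ :=
  if hh : MemLp (D.indicator h) 2 (volume : Measure Plane) then W (hh.toLp _) else 0

/-- `u` is the mild solution of the stochastic Helmholtz problem with wavenumber `k` and source
`g + σ Ẇ` in `(-a, a)²`: a process with almost surely continuous paths such that, for each `x`,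
almost surely `u(x) = ∫ G_k(x,y) g(y) dy + ∫ G_k(x,y) σ(y) dW_y`. -/
structure IsMildSolution {Ω : Type*} [MeasurableSpace Ω] (P : Measure Ω)
    (W : Lp ℝ 2 (volume : Measure Plane) →ₗ[ℝ] Lp ℝ 2 P)
    (a k : ℝ) (g σ : Plane → ℝ) (u : Plane → Ω → ℂ) : Prop where
  continuous_paths : ∀ᵐ ω ∂P, Continuous fun x => u x ω
  eq_integral : ∀ x, ∀ᵐ ω ∂P, u x ω =
    (∫ y in square a, green k x y * (g y : ℂ))
      + (wienerIntegral W (square a) (fun y => (green k x y).re * σ y) ω : ℂ)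
      + Complex.I * (wienerIntegral W (square a) (fun y => (green k x y).im * σ y) ω : ℂ)

/-- The expectation `E(w(x))` of a complex random field. -/
def mean {Ω : Type*} [MeasurableSpace Ω] (P : Measure Ω) (w : Plane → Ω → ℂ) (x : Plane) : ℂ :=
  ∫ ω, w x ω ∂P

/-- The second moment `E(|w(x)|²)` of a complex random field. -/
def meanSq {Ω : Type*} [MeasurableSpace Ω] (P : Measure Ω) (w : Plane → Ω → ℂ) (x : Plane) : ℝ :=
  ∫ ω, ‖w x ω‖ ^ 2 ∂P

/-! ### Wavenumbers and parameters -/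

/-- The small wavenumber `k* = π / (30 a)`. -/
def kStar (a : ℝ) : ℝ := Real.pi / (30 * a)

/-- The admissible wavenumbers. -/
def admissible (a : ℝ) : Set ℝ := {k | ∃ x : ℝ, 1 ≤ x ∧ k = Real.pi / a * x} ∪ {kStar a}

open Classical in
/-- The radius `R` of the measurement circle. -/
def radius (a τ k : ℝ) : ℝ := if k = kStar a then 6 * a else τ * a

open Classical in
/-- The coefficients `λ_{j,1}` (index `0`) and `λ_{j,2}` (index `1`); they do not depend on `j`. -/
def lam (a τ k : ℝ) : Fin 2 → ℝ :=
  ![1 / 2, if k = kStar a then -(3 / 2) else 1 / 2 + Real.pi / (2 * k * radius a τ k)]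

/-! ### Geometry -/

/-- The angle `ν_μ = μ π / m`. -/
def nu (m : ℕ) (μ : ℝ) : ℝ := μ * Real.pi / m

/-- The point with polar coordinates `(r, θ)`. -/
def polar (r θ : ℝ) : Plane := !₂[r * Real.cos θ, r * Real.sin θ]

/-- The angles that parametrize the arc `∂B_j`, `j = 1, …, m`. -/
def arcAngles (m j : ℕ) : Set ℝ := Set.Icc (nu m (2 * (j : ℝ) - 2)) (nu m (2 * (j : ℝ)))

/-- The arc `∂B_j` of the circle of radius `R`. -/
def arc (R : ℝ) (m j : ℕ) : Set Plane := polar R '' arcAngles m j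

/-- The arc-length measure of `∂B_j`. -/
def arcMeasure (R : ℝ) (m j : ℕ) : Measure Plane :=
  ENNReal.ofReal R • (volume.restrict (arcAngles m j)).map (polar R)

/-- The norm `‖·‖_{j,∞}` of `L^∞(∂B_j)`, with values in `[0, ∞]`. -/
def linf {F : Type*} [NormedAddCommGroup F] (R : ℝ) (m j : ℕ) (f : Plane → F) : ℝ≥0∞ :=
  eLpNorm f ∞ (arcMeasure R m j)

/-- The reference point `z_{j,ℓ}`. -/
def refPoint (a τ k : ℝ) (m j : ℕ) (l : Fin 2) : Plane :=
  polar (lam a τ k l * radius a τ k) (nu m (2 * (j : ℝ) - 1))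

/-- The distance `r_{j,ℓ} = |x - z_{j,ℓ}|`. -/
def refDist (a τ k : ℝ) (m j : ℕ) (l : Fin 2) (x : Plane) : ℝ := ‖x - refPoint a τ k m j l‖

/-! ### Recovery of the mean from perturbed phaseless data -/

/-- The scaling factor `c^ε_{j,ℓ,k}` computed from the measured modulus `pu` of the mean of `u`. -/
def scaling (a τ k : ℝ) (m j : ℕ) (pu : Plane → ℝ) (l : Fin 2) : ℝ :=
  (linf (radius a τ k) m j pu).toReal /
    (linf (radius a τ k) m j fun x => green k x (refPoint a τ k m j l)).toReal

/-- The field `v̂_{j,ℓ,k} = u + c^ε_{j,ℓ,k} G_k(·, z_{j,ℓ})`, radiated by the source together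
with the reference point source of strength `c^ε_{j,ℓ,k}`. -/
def vHat {Ω : Type*} (a τ k : ℝ) (m j : ℕ) (pu : Plane → ℝ) (u : Plane → Ω → ℂ) (l : Fin 2) :
    Plane → Ω → ℂ :=
  fun x ω => u x ω + (scaling a τ k m j pu l : ℂ) * green k x (refPoint a τ k m j l)

/-- The right-hand side `f^ε_{j,ℓ,k}` computed from the measured moduli `pu` of the mean of `u`
and `pv ℓ` of the mean of `v̂_{j,ℓ,k}`. -/
def rhs (a τ k : ℝ) (m j : ℕ) (pu : Plane → ℝ) (pv : Fin 2 → Plane → ℝ) (l : Fin 2)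
    (x : Plane) : ℝ :=
  2 / scaling a τ k m j pu l * (pv l x ^ 2 - pu x ^ 2)
    - scaling a τ k m j pu l / 8 * ‖hankel0 (k * refDist a τ k m j l x)‖ ^ 2

/-- `Y₀(k r_{j,ℓ})` at the point `x`. -/
def Yref (a τ k : ℝ) (m j : ℕ) (l : Fin 2) (x : Plane) : ℝ :=
  besselY0 (k * refDist a τ k m j l x)

/-- `J₀(k r_{j,ℓ})` at the point `x`. -/
def Jref (a τ k : ℝ) (m j : ℕ) (l : Fin 2) (x : Plane) : ℝ :=
  besselJ0 (k * refDist a τ k m j l x)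

/-- The coefficient matrix `A_{j,k}` at the point `x`. -/
def matA (a τ k : ℝ) (m j : ℕ) (x : Plane) : Matrix (Fin 2) (Fin 2) ℝ :=
  !![Yref a τ k m j 0 x, -Jref a τ k m j 0 x;
     Yref a τ k m j 1 x, -Jref a τ k m j 1 x]

/-- The matrix `A^R_{j,k}` with right-hand side `f`. -/
def matAR (a τ k : ℝ) (m j : ℕ) (f : Fin 2 → Plane → ℝ) (x : Plane) :
    Matrix (Fin 2) (Fin 2) ℝ :=
  !![f 0 x, -Jref a τ k m j 0 x;
     f 1 x, -Jref a τ k m j 1 x]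

/-- The matrix `A^I_{j,k}` with right-hand side `f`. -/
def matAI (a τ k : ℝ) (m j : ℕ) (f : Fin 2 → Plane → ℝ) (x : Plane) :
    Matrix (Fin 2) (Fin 2) ℝ :=
  !![Yref a τ k m j 0 x, f 0 x;
     Yref a τ k m j 1 x, f 1 x]

/-- The recovered mean `E^ε(u_{j,k})`: its real and imaginary parts are the solution
`det A^R / det A`, `det A^I / det A` of the perturbed linear system with right-hand sides
`f^ε_{j,1,k}`, `f^ε_{j,2,k}`. -/
def recoveredMean (a τ k : ℝ) (m j : ℕ) (pu : Plane → ℝ) (pv : Fin 2 → Plane → ℝ)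
    (x : Plane) : ℂ :=
  (((matAR a τ k m j (rhs a τ k m j pu pv) x).det / (matA a τ k m j x).det : ℝ) : ℂ)
    + Complex.I *
      (((matAI a τ k m j (rhs a τ k m j pu pv) x).det / (matA a τ k m j x).det : ℝ) : ℂ)

/-- The constant `C_ε`. -/
def stabConst (ε : ℝ) : ℝ := (2.5 * (2 + ε) ^ 2 * (3 + ε) + 20) / (1 - ε)

end PhaseRetrieval

end

/-!
The linear system for the mean comes from a polarization identity: adding `c G_k(·, z)` to a complex
number `U` changes its squared modulus by a real linear functional of `U` with coefficients
`Y₀(k r)` and `-J₀(k r)`, up to the known term in `|H₀(k r)|²` (`polarization`).  Relative errors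
`ε` in the measured moduli therefore perturb the right-hand side for `z_ℓ` by at most
`ε B_ℓ M (2 + ε) ((2 + ε)² + 1) / (2 (1 - ε))`, where `M` is the sup norm of the mean and `B_ℓ` bounds
`|H₀(k r_ℓ)|` on the arc (`abs_perturbed_rhs_sub_le`).  By Cramer's rule the error of the recovered
mean is at most the sum of these perturbations, each weighted with the other bound, divided by
`|det A|` (`norm_cramer_sub_le`).  So everything rests on the inequality `B₀ B₁ ≤ 3.6 |det A|`
(`exists_amplitude_bounds`), after which the constant `C_ε` absorbs the rest (`stabConst_bound`).

For large wavenumbers that inequality follows from Bessel's equation in Liouville normal form: the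
functions `√t J₀(t)` and `√t Y₀(t)` solve `w'' = -(1 + 1 / (4 t²)) w`.  The energy
`w'² + (1 + 1 / (4 t²)) w²` is nonincreasing, so its value at `t = 2`, computed from the power series,
gives `|H₀(t)|² ≤ 1.4 / t` (`hankel_amplitude`).  As a function of `s`, the determinant
`√(s t) (J₀(s) Y₀(t) - J₀(t) Y₀(s))` solves the same equation, vanishes at `s = t` and has slope
`-2 / π` there by the Wronskian (`bessel_wronskian`); hence it is close to `-(2 / π) sin (s - t)`
(`phase_determinant_lower`).  The choice of `λ₂` makes the phase difference `k r₁ - k r₂` almost a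
quarter period along the whole arc (`scaled_distances_large`).  For the small wavenumber `k*` the
arguments `k r_ℓ` stay in two short intervals near `1 / 3` and `π / 2`, where the power series give the
values directly.
-/

noncomputable section

namespace PhaseRetrieval

/-! ### Entire power series with factorially decaying coefficients -/

lemma summable_powerSeries {a : ℕ → ℝ} {C : ℝ} (h : ∀ p, |a p| ≤ C / p.factorial) (x : ℝ) :
    Summable fun p => a p * x ^ p := by
  refine Summable.of_norm_bounded (g := fun p : ℕ => C * (|x| ^ p / p.factorial))
    ((Real.summable_pow_div_factorial |x|).mul_left C) fun p => ?_
  rw [Real.norm_eq_abs, abs_mul, abs_pow]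
  calc |a p| * |x| ^ p ≤ C / p.factorial * |x| ^ p := by gcongr; exact h p
    _ = _ := by ring

/-- Termwise differentiation.  The class of coefficients bounded by `C / p!` is stable under
it, with the same constant. -/
lemma hasDerivAt_powerSeries {a : ℕ → ℝ} {C : ℝ} (h : ∀ p, |a p| ≤ C / p.factorial) (x : ℝ) :
    HasDerivAt (fun y => ∑' p, a p * y ^ p) (∑' p : ℕ, ((p : ℝ) + 1) * a (p + 1) * x ^ p) x := by
  have hC : 0 ≤ C := by simpa using (abs_nonneg _).trans (h 0)
  set r := |x| + 1 with hr
  have hr0 : 0 ≤ r := by positivity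
  set v : ℕ → ℝ := fun p => p * (C / p.factorial) * r ^ (p - 1) with hv
  have hvs : Summable v := by
    rw [← summable_nat_add_iff 1]
    refine ((Real.summable_pow_div_factorial r).mul_left C).congr fun p => ?_
    simp only [hv, Nat.add_sub_cancel, Nat.factorial_succ]
    push_cast
    field_simp
  have key := hasDerivAt_tsum_of_isPreconnected (g := fun p y => a p * y ^ p)
    (g' := fun p y => a p * (p * y ^ (p - 1))) (t := Metric.ball (0 : ℝ) r) (y₀ := 0) (y := x)
    hvs Metric.isOpen_ball (convex_ball (0 : ℝ) r).isPreconnected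
    (fun p y _ => (hasDerivAt_pow p y).const_mul _)
    (fun p y hy => by
      have hy' : |y| ≤ r := by simpa using (Metric.mem_ball.1 hy).le
      rw [Real.norm_eq_abs, abs_mul, abs_mul, abs_pow, Nat.abs_cast]
      calc |a p| * (p * |y| ^ (p - 1)) ≤ C / p.factorial * (p * r ^ (p - 1)) := by
            gcongr; exact h p
        _ = v p := by simp only [hv]; ring)
    (by simp [hr]; positivity) (summable_powerSeries h 0) (by simp [hr])
  refine key.congr_deriv (Eq.symm ?_)
  have hs : Summable fun p : ℕ => a p * (p * x ^ (p - 1)) := by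
    refine Summable.of_norm_bounded hvs fun p => ?_
    rw [Real.norm_eq_abs, abs_mul, abs_mul, abs_pow, Nat.abs_cast]
    calc |a p| * (p * |x| ^ (p - 1)) ≤ C / p.factorial * (p * r ^ (p - 1)) := by
          gcongr; exacts [h p, by simp [hr]]
      _ = v p := by simp only [hv]; ring
  rw [hs.tsum_eq_zero_add]
  simp only [Nat.cast_zero, zero_mul, mul_zero, zero_add, Nat.add_sub_cancel]
  refine tsum_congr fun p => ?_
  push_cast
  ring

/-- Multiplying the coefficients by the index is the Euler operator `x d/dx`. -/
lemma tsum_index_mul {a : ℕ → ℝ} {C : ℝ} (h : ∀ p : ℕ, |(p : ℝ) * a p| ≤ C / p.factorial) (x : ℝ) :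
    ∑' p : ℕ, (p : ℝ) * a p * x ^ p = x * ∑' p : ℕ, ((p : ℝ) + 1) * a (p + 1) * x ^ p := by
  rw [(summable_powerSeries h x).tsum_eq_zero_add, ← tsum_mul_left]
  simp only [Nat.cast_zero, zero_mul, zero_add]
  refine tsum_congr fun p => ?_
  push_cast
  ring

/-- Truncation error on `[-1, 1]` after six terms: the remaining coefficients are dominated by a
geometric sequence of ratio `1 / 2`. -/
lemma abs_powerSeries_sub_le {a : ℕ → ℝ} (h : ∀ p, |a (p + 1)| ≤ 1 / (p.factorial : ℝ) ^ 2)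
    {x : ℝ} (hx : |x| ≤ 1) :
    |∑' p, a p * x ^ p - ∑ p ∈ Finset.range 6, a p * x ^ p| ≤ 1 / 7200 := by
  have hfac : ∀ q : ℕ, (120 : ℝ) ^ 2 * 2 ^ q ≤ ((q + 5).factorial : ℝ) ^ 2 := by
    intro q
    induction q with
    | zero => norm_num [Nat.factorial]
    | succ q ih =>
      rw [show q + 1 + 5 = (q + 5) + 1 by ring, Nat.factorial_succ]
      push_cast
      have : (2 : ℝ) ≤ ((q : ℝ) + 5 + 1) ^ 2 := by
        have : (0 : ℝ) ≤ q := q.cast_nonneg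
        nlinarith
      calc (120 : ℝ) ^ 2 * 2 ^ (q + 1) = 2 * ((120 : ℝ) ^ 2 * 2 ^ q) := by ring
        _ ≤ ((q : ℝ) + 5 + 1) ^ 2 * ((q + 5).factorial : ℝ) ^ 2 := by gcongr
        _ = _ := by ring
  have hb : ∀ q : ℕ, ‖a (q + 6) * x ^ (q + 6)‖ ≤ 1 / 14400 * (1 / 2 : ℝ) ^ q := by
    intro q
    rw [Real.norm_eq_abs, abs_mul, abs_pow]
    calc |a (q + 6)| * |x| ^ (q + 6) ≤ 1 / ((q + 5).factorial : ℝ) ^ 2 * 1 := by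
          gcongr
          · exact h (q + 5)
          · exact pow_le_one₀ (abs_nonneg _) hx
      _ ≤ 1 / ((120 : ℝ) ^ 2 * 2 ^ q) := by
          rw [mul_one]
          exact one_div_le_one_div_of_le (by positivity) (hfac q)
      _ = _ := by rw [one_div_pow]; field_simp; norm_num
  have hgeo : HasSum (fun q : ℕ => 1 / 14400 * (1 / 2 : ℝ) ^ q) (1 / 14400 * 2) :=
    hasSum_geometric_two.mul_left _
  have hs : Summable fun p => a p * x ^ p :=
    (summable_nat_add_iff 6).1 (Summable.of_norm_bounded hgeo.summable hb)
  rw [← hs.sum_add_tsum_nat_add 6, add_sub_cancel_left, ← Real.norm_eq_abs]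
  exact (tsum_of_norm_bounded hgeo hb).trans (by norm_num)

/-! ### The Bessel functions and their derivatives -/

/-- Coefficients of `J₀` as a power series in `t² / 4`. -/
def coeffJ (p : ℕ) : ℝ := (-1) ^ p / (p.factorial : ℝ) ^ 2

/-- Coefficients, in powers of `t² / 4`, of the entire part of `Y₀`. -/
def coeffS (p : ℕ) : ℝ := (-1) ^ p * ((harmonic p : ℚ) : ℝ) / (p.factorial : ℝ) ^ 2

/-- The entire series `S` with `Y₀(t) = (2 / π) ((log (t / 2) + γ) J₀(t) - S(t))`. -/
def besselS (t : ℝ) : ℝ := ∑' p, coeffS p * (t ^ 2 / 4) ^ p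

/-- The scaled derivative `t J₀'(t)`. -/
def eulerJ (t : ℝ) : ℝ := 2 * ∑' p : ℕ, (p : ℝ) * coeffJ p * (t ^ 2 / 4) ^ p

/-- The scaled derivative `t S'(t)` of `S = besselS`. -/
def eulerS (t : ℝ) : ℝ := 2 * ∑' p : ℕ, (p : ℝ) * coeffS p * (t ^ 2 / 4) ^ p

/-- The scaled derivative `t Y₀'(t)`. -/
def eulerY (t : ℝ) : ℝ :=
  2 / Real.pi * (besselJ0 t + (Real.log (t / 2) + Real.eulerMascheroniConstant) * eulerJ t
    - eulerS t)

lemma besselJ0_eq (t : ℝ) : besselJ0 t = ∑' p, coeffJ p * (t ^ 2 / 4) ^ p := by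
  unfold besselJ0 coeffJ
  refine tsum_congr fun p => ?_
  rw [pow_mul, show t ^ 2 / 4 = (t / 2) ^ 2 by ring]

lemma besselY0_eq (t : ℝ) : besselY0 t = 2 / Real.pi *
    ((Real.log (t / 2) + Real.eulerMascheroniConstant) * besselJ0 t - besselS t) := by
  have : besselS t = ∑' p : ℕ,
      (-1 : ℝ) ^ p * ((harmonic p : ℚ) : ℝ) / (p.factorial : ℝ) ^ 2 * (t / 2) ^ (2 * p) := by
    refine tsum_congr fun p => ?_
    rw [coeffS, pow_mul, show t ^ 2 / 4 = (t / 2) ^ 2 by ring]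
  rw [besselY0, this]; ring

lemma harmonic_nonneg_real (p : ℕ) : (0 : ℝ) ≤ ((harmonic p : ℚ) : ℝ) := by
  have : (0 : ℚ) ≤ harmonic p := Finset.sum_nonneg fun i _ => by positivity
  exact_mod_cast this

lemma harmonic_le_self (p : ℕ) : ((harmonic p : ℚ) : ℝ) ≤ p := by
  induction p with
  | zero => simp
  | succ p ih =>
    rw [harmonic_succ]
    push_cast
    have : ((p : ℝ) + 1)⁻¹ ≤ 1 := inv_le_one_of_one_le₀ (by linarith [p.cast_nonneg (α := ℝ)])
    linarith

lemma abs_coeffJ (p : ℕ) : |coeffJ p| = 1 / (p.factorial : ℝ) ^ 2 := by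
  simp [coeffJ, abs_div]

lemma abs_coeffS (p : ℕ) : |coeffS p| = ((harmonic p : ℚ) : ℝ) / (p.factorial : ℝ) ^ 2 := by
  simp [coeffS, abs_div, abs_mul, abs_of_nonneg (harmonic_nonneg_real p)]

/-- The common bound for the four families of coefficients `c_p`, `p c_p`. -/
lemma bound_of_le_sq {b : ℝ} {p : ℕ} (h : b ≤ ((p : ℝ) + 1) ^ 2 / ((p + 1).factorial : ℝ) ^ 2) :
    b ≤ 1 / (p.factorial : ℝ) ^ 2 := by
  refine h.trans_eq ?_
  rw [Nat.factorial_succ]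
  push_cast
  field_simp

lemma abs_coeffJ_succ (p : ℕ) : |coeffJ (p + 1)| ≤ 1 / (p.factorial : ℝ) ^ 2 := by
  refine bound_of_le_sq ?_
  rw [abs_coeffJ]
  gcongr
  nlinarith [p.cast_nonneg (α := ℝ)]

lemma abs_index_coeffJ_succ (p : ℕ) :
    |((p + 1 : ℕ) : ℝ) * coeffJ (p + 1)| ≤ 1 / (p.factorial : ℝ) ^ 2 := by
  refine bound_of_le_sq ?_
  rw [abs_mul, abs_coeffJ, Nat.abs_cast, mul_one_div]
  gcongr
  push_cast
  nlinarith [p.cast_nonneg (α := ℝ)]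

lemma abs_coeffS_succ (p : ℕ) : |coeffS (p + 1)| ≤ 1 / (p.factorial : ℝ) ^ 2 := by
  refine bound_of_le_sq ?_
  rw [abs_coeffS]
  gcongr
  have := harmonic_le_self (p + 1)
  push_cast at this ⊢
  nlinarith [p.cast_nonneg (α := ℝ)]

lemma abs_index_coeffS_succ (p : ℕ) :
    |((p + 1 : ℕ) : ℝ) * coeffS (p + 1)| ≤ 1 / (p.factorial : ℝ) ^ 2 := by
  refine bound_of_le_sq ?_
  rw [abs_mul, abs_coeffS, Nat.abs_cast, mul_div_assoc']
  gcongr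
  have := harmonic_le_self (p + 1)
  push_cast at this ⊢
  nlinarith [p.cast_nonneg (α := ℝ)]

lemma le_two_div_factorial {a : ℕ → ℝ} (h0 : |a 0| ≤ 2)
    (h : ∀ p, |a (p + 1)| ≤ 1 / (p.factorial : ℝ) ^ 2) (p : ℕ) : |a p| ≤ 2 / p.factorial := by
  cases p with
  | zero => simpa using h0
  | succ p =>
    refine (h p).trans ?_
    have hp : (p : ℝ) + 1 ≤ 2 * p.factorial := by
      have h1 : 1 ≤ p.factorial := p.factorial_pos
      have h2 : p ≤ p.factorial := p.self_le_factorial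
      exact_mod_cast (by omega : p + 1 ≤ 2 * p.factorial)
    have hf : (0 : ℝ) < p.factorial := by exact_mod_cast p.factorial_pos
    rw [Nat.factorial_succ]
    push_cast
    rw [div_le_div_iff₀ (by positivity) (by positivity)]
    nlinarith

lemma coeffJ_le (p : ℕ) : |coeffJ p| ≤ 2 / p.factorial :=
  le_two_div_factorial (by norm_num [coeffJ]) abs_coeffJ_succ p

lemma index_coeffJ_le (p : ℕ) : |(p : ℝ) * coeffJ p| ≤ 2 / p.factorial :=
  le_two_div_factorial (a := fun p : ℕ => (p : ℝ) * coeffJ p) (by norm_num) abs_index_coeffJ_succ p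

lemma coeffS_le (p : ℕ) : |coeffS p| ≤ 2 / p.factorial :=
  le_two_div_factorial (by norm_num [coeffS]) abs_coeffS_succ p

lemma index_coeffS_le (p : ℕ) : |(p : ℝ) * coeffS p| ≤ 2 / p.factorial :=
  le_two_div_factorial (a := fun p : ℕ => (p : ℝ) * coeffS p) (by norm_num) abs_index_coeffS_succ p

lemma hasDerivAt_comp_sq_div {f : ℝ → ℝ} {f' t : ℝ} (h : HasDerivAt f f' (t ^ 2 / 4)) :
    HasDerivAt (fun y => f (y ^ 2 / 4)) (f' * (t / 2)) t := by
  have h2 : HasDerivAt (fun y : ℝ => y ^ 2 / 4) (t / 2) t :=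
    ((hasDerivAt_pow 2 t).div_const 4).congr_deriv (by push_cast; ring)
  exact h.comp t h2

lemma hasDerivAt_besselJ0 {t : ℝ} (ht : t ≠ 0) : HasDerivAt besselJ0 (eulerJ t / t) t := by
  have h := hasDerivAt_comp_sq_div (hasDerivAt_powerSeries coeffJ_le (t ^ 2 / 4))
  rw [show besselJ0 = fun y => ∑' p, coeffJ p * (y ^ 2 / 4) ^ p from funext besselJ0_eq]
  refine h.congr_deriv ?_
  rw [eulerJ, tsum_index_mul index_coeffJ_le]
  field_simp
  ring

lemma hasDerivAt_besselS {t : ℝ} (ht : t ≠ 0) : HasDerivAt besselS (eulerS t / t) t := by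
  have h := hasDerivAt_comp_sq_div (hasDerivAt_powerSeries coeffS_le (t ^ 2 / 4))
  refine h.congr_deriv ?_
  rw [eulerS, tsum_index_mul index_coeffS_le]
  field_simp
  ring

/-- Bessel's equation `(t J₀')' = -t J₀`. -/
lemma hasDerivAt_eulerJ (t : ℝ) : HasDerivAt eulerJ (-t * besselJ0 t) t := by
  have h := (hasDerivAt_comp_sq_div (hasDerivAt_powerSeries index_coeffJ_le (t ^ 2 / 4))).const_mul 2
  refine h.congr_deriv ?_
  have : ∑' p : ℕ, ((p : ℝ) + 1) * (((p + 1 : ℕ) : ℝ) * coeffJ (p + 1)) * (t ^ 2 / 4) ^ p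
      = -besselJ0 t := by
    rw [besselJ0_eq, ← tsum_neg]
    refine tsum_congr fun p => ?_
    rw [coeffJ, coeffJ, Nat.factorial_succ]
    push_cast
    field_simp
    ring
  rw [this]; ring

/-- The inhomogeneous equation `(t S')' = -t S + 2 J₀'`. -/
lemma hasDerivAt_eulerS {t : ℝ} (ht : t ≠ 0) :
    HasDerivAt eulerS (-t * besselS t + 2 * (eulerJ t / t)) t := by
  have h := (hasDerivAt_comp_sq_div (hasDerivAt_powerSeries index_coeffS_le (t ^ 2 / 4))).const_mul 2
  refine h.congr_deriv ?_
  have hs1 := summable_powerSeries coeffS_le (t ^ 2 / 4)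
  have hs2 : Summable fun p : ℕ => ((p : ℝ) + 1) * coeffJ (p + 1) * (t ^ 2 / 4) ^ p := by
    refine summable_powerSeries (C := 2) (fun p => ?_) _
    have := index_coeffJ_le (p + 1)
    rw [Nat.cast_add_one] at this
    refine this.trans ?_
    gcongr
    exact Nat.le_succ p
  have : ∑' p : ℕ, ((p : ℝ) + 1) * (((p + 1 : ℕ) : ℝ) * coeffS (p + 1)) * (t ^ 2 / 4) ^ p
      = -besselS t + ∑' p : ℕ, ((p : ℝ) + 1) * coeffJ (p + 1) * (t ^ 2 / 4) ^ p := by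
    rw [besselS, ← tsum_neg, ← hs1.neg.tsum_add hs2]
    refine tsum_congr fun p => ?_
    rw [coeffS, coeffS, coeffJ, harmonic_succ, Nat.factorial_succ]
    push_cast
    field_simp
    ring
  rw [this, eulerJ, tsum_index_mul index_coeffJ_le]
  field_simp
  ring

lemma hasDerivAt_log_add {t : ℝ} (ht : 0 < t) : HasDerivAt
    (fun y => Real.log (y / 2) + Real.eulerMascheroniConstant) (1 / t) t := by
  have h := (((hasDerivAt_id t).div_const 2).log
    (by simpa using ht.ne')).add_const Real.eulerMascheroniConstant
  refine h.congr_deriv ?_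
  simp only [id]
  field_simp

lemma hasDerivAt_besselY0 {t : ℝ} (ht : 0 < t) : HasDerivAt besselY0 (eulerY t / t) t := by
  have h := (((hasDerivAt_log_add ht).mul (hasDerivAt_besselJ0 ht.ne')).sub
    (hasDerivAt_besselS ht.ne')).const_mul (2 / Real.pi)
  rw [show besselY0 = _ from funext besselY0_eq]
  refine h.congr_deriv ?_
  rw [eulerY]
  field_simp

/-- Bessel's equation `(t Y₀')' = -t Y₀`. -/
lemma hasDerivAt_eulerY {t : ℝ} (ht : 0 < t) : HasDerivAt eulerY (-t * besselY0 t) t := by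
  have h := (((hasDerivAt_besselJ0 ht.ne').add
    ((hasDerivAt_log_add ht).mul (hasDerivAt_eulerJ t))).sub
    (hasDerivAt_eulerS ht.ne')).const_mul (2 / Real.pi)
  refine h.congr_deriv ?_
  rw [besselY0_eq]
  field_simp
  ring

/-- The Wronskian of `J₀` and `Y₀` is `2 / (π t)`.  The logarithms cancel in
`J₀ (t Y₀') - (t J₀') Y₀`, so that it extends continuously to `t = 0`, where its value is known. -/
lemma bessel_wronskian {t : ℝ} (ht : 0 < t) :
    besselJ0 t * eulerY t - eulerJ t * besselY0 t = 2 / Real.pi := by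
  set K : ℝ → ℝ := fun y => besselJ0 y ^ 2 - besselJ0 y * eulerS y + eulerJ y * besselS y with hK
  have hc : ∀ {a : ℕ → ℝ}, (∀ p, |a p| ≤ 2 / p.factorial) →
      Continuous fun y : ℝ => ∑' p, a p * (y ^ 2 / 4) ^ p := fun h =>
    continuous_iff_continuousAt.2 fun y =>
      (hasDerivAt_comp_sq_div (hasDerivAt_powerSeries h (y ^ 2 / 4))).continuousAt
  have hJ : Continuous besselJ0 := by
    rw [show besselJ0 = _ from funext besselJ0_eq]; exact hc coeffJ_le
  have hS : Continuous besselS := hc coeffS_le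
  have hP : Continuous eulerJ := continuous_const.mul (hc index_coeffJ_le)
  have hQ : Continuous eulerS := continuous_const.mul (hc index_coeffS_le)
  have hKc : Continuous K := by fun_prop
  obtain ⟨c, hcm, hslope⟩ := exists_hasDerivAt_eq_slope K (fun _ => 0) ht hKc.continuousOn
    fun y hy => by
      have hy0 : y ≠ 0 := hy.1.ne'
      have h := (((hasDerivAt_besselJ0 hy0).pow 2).sub
        ((hasDerivAt_besselJ0 hy0).mul (hasDerivAt_eulerS hy0))).add
        ((hasDerivAt_eulerJ y).mul (hasDerivAt_besselS hy0))
      refine h.congr_deriv ?_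
      field_simp
      ring
  have hz : ∀ a : ℕ → ℝ, ∑' p, a p * ((0 : ℝ) ^ 2 / 4) ^ p = a 0 := by
    intro a
    rw [tsum_eq_single 0 (fun p hp => by simp [hp])]
    simp
  have hK0 : K 0 = 1 := by
    have h1 : besselJ0 0 = 1 := by rw [besselJ0_eq, hz]; simp [coeffJ]
    have h2 : eulerS 0 = 0 := by rw [eulerS, hz fun p => (p : ℝ) * coeffS p]; simp
    have h3 : eulerJ 0 = 0 := by rw [eulerJ, hz fun p => (p : ℝ) * coeffJ p]; simp
    simp [hK, h1, h2, h3]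
  have hKt : K t = 1 := by
    rw [eq_div_iff (by linarith)] at hslope
    linarith
  rw [eulerY, besselY0_eq]
  linear_combination 2 / Real.pi * hKt

/-! ### The Liouville normal form of Bessel's equation -/

/-- `w` solves `w'' = -(1 + 1 / (4 t²)) w` on `(0, ∞)` with derivative `w₁`.  This is the equation
satisfied by `√t Z₀(t)` for each Bessel function `Z₀` of order zero. -/
def IsLiouvilleSolution (w w₁ : ℝ → ℝ) : Prop :=
  ∀ t, 0 < t → HasDerivAt w (w₁ t) t ∧ HasDerivAt w₁ (-(1 + 1 / (4 * t ^ 2)) * w t) t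

lemma isLiouvilleSolution_sqrt_mul {f F : ℝ → ℝ}
    (hf : ∀ t, 0 < t → HasDerivAt f (F t / t) t)
    (hF : ∀ t, 0 < t → HasDerivAt F (-t * f t) t) :
    IsLiouvilleSolution (fun t => √t * f t) (fun t => (F t + f t / 2) / √t) := by
  intro t ht
  have hs : 0 < √t := Real.sqrt_pos.2 ht
  have hq := Real.hasDerivAt_sqrt ht.ne'
  have h2 : √t ^ 2 = t := Real.sq_sqrt ht.le
  constructor
  · refine (hq.mul (hf t ht)).congr_deriv ?_
    beta_reduce
    generalize √t = r at *
    subst h2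
    field_simp
    ring
  · refine (((hF t ht).add ((hf t ht).div_const 2)).div hq hs.ne').congr_deriv ?_
    simp only [Pi.add_apply]
    generalize √t = r at *
    subst h2
    field_simp
    ring

lemma IsLiouvilleSolution.mul_sub_mul {w w₁ v v₁ : ℝ → ℝ} (hw : IsLiouvilleSolution w w₁)
    (hv : IsLiouvilleSolution v v₁) (α β : ℝ) :
    IsLiouvilleSolution (fun t => w t * α - v t * β) (fun t => w₁ t * α - v₁ t * β) := by
  intro t ht
  refine ⟨((hw t ht).1.mul_const α).sub ((hv t ht).1.mul_const β), ?_⟩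
  refine (((hw t ht).2.mul_const α).sub ((hv t ht).2.mul_const β)).congr_deriv ?_
  ring

/-- The energy `w'² + (1 + 1 / (4 t²)) w²` is nonincreasing because the coefficient is. -/
lemma IsLiouvilleSolution.energy_le {w w₁ : ℝ → ℝ} (h : IsLiouvilleSolution w w₁) {s t : ℝ}
    (hs : 0 < s) (hst : s ≤ t) :
    w₁ t ^ 2 + (1 + 1 / (4 * t ^ 2)) * w t ^ 2 ≤ w₁ s ^ 2 + (1 + 1 / (4 * s ^ 2)) * w s ^ 2 := by
  have hd : ∀ y, 0 < y → HasDerivAt (fun y => w₁ y ^ 2 + (1 + 1 / (4 * y ^ 2)) * w y ^ 2)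
      (-(1 / (2 * y ^ 3)) * w y ^ 2) y := by
    intro y hy
    have hc : HasDerivAt (fun y : ℝ => 1 + 1 / (4 * y ^ 2)) (-(1 / (2 * y ^ 3))) y := by
      refine (((hasDerivAt_const y (1 : ℝ)).div ((hasDerivAt_pow 2 y).const_mul 4)
        (by positivity)).const_add 1).congr_deriv ?_
      push_cast
      field_simp
      ring
    refine (((h y hy).2.pow 2).add (hc.mul ((h y hy).1.pow 2))).congr_deriv ?_
    simp only [Pi.pow_apply]
    push_cast
    ring
  have hanti : AntitoneOn (fun y => w₁ y ^ 2 + (1 + 1 / (4 * y ^ 2)) * w y ^ 2) (Set.Ioi 0) := by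
    refine antitoneOn_of_deriv_nonpos (convex_Ioi 0)
      (fun y hy => (hd y hy).continuousAt.continuousWithinAt) ?_ ?_
    · rw [interior_Ioi]
      exact fun y hy => (hd y hy).differentiableAt.differentiableWithinAt
    · rw [interior_Ioi]
      intro y hy
      have hy0 : 0 < y := hy
      rw [(hd y hy).deriv]
      have : 0 ≤ 1 / (2 * y ^ 3) * w y ^ 2 := by positivity
      linarith
  exact hanti hs (hs.trans_le hst) hst

/-- A solution that vanishes at `t` stays close to the sine wave with the same initial slope. -/
lemma IsLiouvilleSolution.abs_sub_sin_le {w w₁ : ℝ → ℝ} (h : IsLiouvilleSolution w w₁) {s t : ℝ}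
    (ht : 0 < t) (hts : t ≤ s) (hw : w t = 0) :
    |w s - w₁ t * Real.sin (s - t)| ≤ |w₁ t| / (4 * t ^ 2) * (s - t) := by
  -- `w(y) cos(s - y) + w'(y) sin(s - y)` interpolates between the two sides; its derivative is
  -- the perturbation `-w(y) sin(s - y) / (4 y²)`, and the energy bounds `|w(y)|` by `|w'(t)|`.
  have hd : ∀ y ∈ Set.Icc t s, HasDerivWithinAt
      (fun y => w y * Real.cos (s - y) + w₁ y * Real.sin (s - y))
      (-(1 / (4 * y ^ 2)) * w y * Real.sin (s - y)) (Set.Icc t s) y := by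
    intro y hy
    have hy0 : 0 < y := ht.trans_le hy.1
    have hsub : HasDerivAt (fun y : ℝ => s - y) (-1) y := (hasDerivAt_id y).const_sub s
    refine ((((h y hy0).1.mul hsub.cos).add ((h y hy0).2.mul hsub.sin)).congr_deriv
      ?_).hasDerivWithinAt
    ring
  have hb : ∀ y ∈ Set.Ico t s, ‖-(1 / (4 * y ^ 2)) * w y * Real.sin (s - y)‖
      ≤ |w₁ t| / (4 * t ^ 2) := by
    intro y hy
    have hy0 : 0 < y := ht.trans_le hy.1
    have hE := h.energy_le ht hy.1
    have hwy : |w y| ≤ |w₁ t| := by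
      refine sq_le_sq.1 ?_
      rw [hw] at hE
      have : 0 ≤ 1 / (4 * y ^ 2) * w y ^ 2 := by positivity
      nlinarith [sq_nonneg (w₁ y)]
    rw [Real.norm_eq_abs, abs_mul, abs_mul, abs_neg, abs_of_nonneg (by positivity)]
    calc 1 / (4 * y ^ 2) * |w y| * |Real.sin (s - y)| ≤ 1 / (4 * t ^ 2) * |w₁ t| * 1 := by
          gcongr
          exacts [hy.1, Real.abs_sin_le_one _]
      _ = _ := by ring
  have := norm_image_sub_le_of_norm_deriv_le_segment' hd hb s ⟨hts, le_rfl⟩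
  simpa [hw] using this

/-! ### Amplitude and phase of the Hankel function -/

lemma isLiouvilleSolution_J :
    IsLiouvilleSolution (fun t => √t * besselJ0 t) (fun t => (eulerJ t + besselJ0 t / 2) / √t) :=
  isLiouvilleSolution_sqrt_mul (fun _ ht => hasDerivAt_besselJ0 ht.ne')
    fun t _ => hasDerivAt_eulerJ t

lemma isLiouvilleSolution_Y :
    IsLiouvilleSolution (fun t => √t * besselY0 t) (fun t => (eulerY t + besselY0 t / 2) / √t) :=
  isLiouvilleSolution_sqrt_mul (fun _ ht => hasDerivAt_besselY0 ht) fun _ ht => hasDerivAt_eulerY ht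

lemma coeffJ_values : coeffJ 0 = 1 ∧ coeffJ 1 = -1 ∧ coeffJ 2 = 1 / 4 ∧ coeffJ 3 = -(1 / 36) ∧
    coeffJ 4 = 1 / 576 ∧ coeffJ 5 = -(1 / 14400) := by
  norm_num [coeffJ, Nat.factorial]

lemma coeffS_values : coeffS 0 = 0 ∧ coeffS 1 = -1 ∧ coeffS 2 = 3 / 8 ∧ coeffS 3 = -(11 / 216) ∧
    coeffS 4 = 25 / 6912 ∧ coeffS 5 = -(137 / 864000) := by
  norm_num [coeffS, Nat.factorial, harmonic, Finset.sum_range_succ]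

lemma abs_besselJ0_sub_le {t x : ℝ} (hx : x = t ^ 2 / 4) (hx1 : x ≤ 1) :
    |besselJ0 t - (1 - x + x ^ 2 / 4 - x ^ 3 / 36 + x ^ 4 / 576 - x ^ 5 / 14400)| ≤ 1 / 7200 := by
  have h := abs_powerSeries_sub_le (x := x) abs_coeffJ_succ
    (abs_le.2 ⟨by rw [hx]; nlinarith [sq_nonneg t], hx1⟩)
  obtain ⟨h0, h1, h2, h3, h4, h5⟩ := coeffJ_values
  simp only [Finset.sum_range_succ, Finset.sum_range_zero, h0, h1, h2, h3, h4, h5] at h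
  rw [besselJ0_eq, ← hx]
  convert h using 3
  ring

lemma abs_besselS_sub_le {t x : ℝ} (hx : x = t ^ 2 / 4) (hx1 : x ≤ 1) :
    |besselS t - (-x + 3 / 8 * x ^ 2 - 11 / 216 * x ^ 3 + 25 / 6912 * x ^ 4
      - 137 / 864000 * x ^ 5)| ≤ 1 / 7200 := by
  have h := abs_powerSeries_sub_le (x := x) abs_coeffS_succ
    (abs_le.2 ⟨by rw [hx]; nlinarith [sq_nonneg t], hx1⟩)
  obtain ⟨h0, h1, h2, h3, h4, h5⟩ := coeffS_values
  simp only [Finset.sum_range_succ, Finset.sum_range_zero, h0, h1, h2, h3, h4, h5] at h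
  rw [besselS, ← hx]
  convert h using 3
  ring

/-- Numerical values at `t = 2`, where the logarithm in `Y₀` vanishes. -/
lemma bessel_values_two :
    |besselJ0 2 - 0.2239| ≤ 0.001 ∧ |besselS 2 + 0.6725| ≤ 0.001 ∧
    |eulerJ 2 + 1.1535| ≤ 0.001 ∧ |eulerS 2 + 0.7782| ≤ 0.001 := by
  have hJ := abs_le.1 (abs_besselJ0_sub_le (t := 2) (x := 1) (by norm_num) le_rfl)
  have hS := abs_le.1 (abs_besselS_sub_le (t := 2) (x := 1) (by norm_num) le_rfl)
  have hP := abs_le.1 (abs_powerSeries_sub_le (a := fun p : ℕ => (p : ℝ) * coeffJ p) (x := 1)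
    abs_index_coeffJ_succ (by norm_num))
  have hQ := abs_le.1 (abs_powerSeries_sub_le (a := fun p : ℕ => (p : ℝ) * coeffS p) (x := 1)
    abs_index_coeffS_succ (by norm_num))
  obtain ⟨h0, h1, h2, h3, h4, h5⟩ := coeffJ_values
  obtain ⟨k0, k1, k2, k3, k4, k5⟩ := coeffS_values
  have e1 : ((2 : ℝ) ^ 2 / 4) = 1 := by norm_num
  simp only [Finset.sum_range_succ, Finset.sum_range_zero, h0, h1, h2, h3, h4, h5, k0, k1, k2, k3,
    k4, k5] at hP hQ
  push_cast at hP hQ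
  rw [eulerJ, eulerS, e1]
  simp only [abs_le]
  refine ⟨⟨?_, ?_⟩, ⟨?_, ?_⟩, ⟨?_, ?_⟩, ⟨?_, ?_⟩⟩ <;> linarith [hJ.1, hJ.2, hS.1, hS.2, hP.1, hP.2,
    hQ.1, hQ.2]

/-- The amplitude bound `|H₀(t)|² ≤ 1.4 / t`, from the energies of `√t J₀` and `√t Y₀` at
`t = 2`. -/
lemma hankel_amplitude {t : ℝ} (ht : 2 ≤ t) :
    t * (besselJ0 t ^ 2 + besselY0 t ^ 2) ≤ 1.4 := by
  have ht0 : 0 < t := by linarith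
  have hJ := isLiouvilleSolution_J.energy_le two_pos ht
  have hY := isLiouvilleSolution_Y.energy_le two_pos ht
  obtain ⟨vJ, vS, vP, vQ⟩ := bessel_values_two
  simp only [abs_le] at vJ vS vP vQ
  simp only [mul_pow, div_pow, Real.sq_sqrt ht0.le, Real.sq_sqrt zero_le_two] at hJ hY
  have hg1 := Real.one_half_lt_eulerMascheroniConstant
  have hg2 := Real.eulerMascheroniConstant_lt_two_thirds
  have eY : besselY0 2 = 2 / Real.pi * (Real.eulerMascheroniConstant * besselJ0 2 - besselS 2) := by
    rw [besselY0_eq]; norm_num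
  have eZ : eulerY 2 = 2 / Real.pi *
      (besselJ0 2 + Real.eulerMascheroniConstant * eulerJ 2 - eulerS 2) := by
    rw [eulerY]; norm_num
  generalize Real.eulerMascheroniConstant = γ at *
  obtain ⟨A, hA⟩ : ∃ A, A = γ * besselJ0 2 - besselS 2 := ⟨_, rfl⟩
  obtain ⟨B, hB⟩ : ∃ B, B = besselJ0 2 + γ * eulerJ 2 - eulerS 2 := ⟨_, rfl⟩
  rw [← hA] at eY
  rw [← hB] at eZ
  have hJ0 : 0 ≤ besselJ0 2 := by linarith
  have hP0 : 0 ≤ -eulerJ 2 := by linarith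
  have hA1 : A ≤ 0.8242 := by linarith [mul_nonneg (sub_nonneg.2 hg2.le) hJ0]
  have hA0 : 0 ≤ A := by linarith [mul_nonneg (sub_nonneg.2 hg1.le) hJ0]
  have hB1 : B ≤ 0.4284 := by linarith [mul_nonneg (sub_nonneg.2 hg1.le) hP0]
  have hB0 : 0 ≤ B := by linarith [mul_nonneg (sub_nonneg.2 hg2.le) hP0]
  have hpi : (2 / Real.pi) ^ 2 ≤ 0.4058 := by
    have : 2 / Real.pi ≤ 2 / 3.14 := by gcongr; exact Real.pi_gt_d2.le
    calc (2 / Real.pi) ^ 2 ≤ (2 / 3.14) ^ 2 := by gcongr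
      _ ≤ _ := by norm_num
  have hYE : (eulerY 2 + besselY0 2 / 2) ^ 2 / 2 + (1 + 1 / (4 * 2 ^ 2)) * (2 * besselY0 2 ^ 2)
      ≤ 0.74 := by
    rw [eY, eZ]
    calc _ = (2 / Real.pi) ^ 2 * ((B + A / 2) ^ 2 / 2 + 17 / 8 * A ^ 2) := by ring
      _ ≤ 0.4058 * ((0.4284 + 0.8242 / 2) ^ 2 / 2 + 17 / 8 * 0.8242 ^ 2) := by gcongr
      _ ≤ 0.74 := by norm_num
  have hJE : (eulerJ 2 + besselJ0 2 / 2) ^ 2 / 2 + (1 + 1 / (4 * 2 ^ 2)) * (2 * besselJ0 2 ^ 2)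
      ≤ 0.66 := by
    have q1 : (eulerJ 2 + besselJ0 2 / 2) ^ 2 ≤ 1.05 ^ 2 := sq_le_sq' (by linarith) (by linarith)
    have q2 : besselJ0 2 ^ 2 ≤ 0.225 ^ 2 := sq_le_sq' (by linarith) (by linarith)
    linarith
  have p1 : 0 ≤ (eulerJ t + besselJ0 t / 2) ^ 2 / t := by positivity
  have p2 : 0 ≤ (eulerY t + besselY0 t / 2) ^ 2 / t := by positivity
  have p3 : 0 ≤ 1 / (4 * t ^ 2) * (t * (besselJ0 t ^ 2 + besselY0 t ^ 2)) := by positivity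
  linarith

/-- Lower bound for the phase determinant of `H₀` at two points at most a quarter period apart:
as a function of `s`, `√(s t) (J₀(s) Y₀(t) - J₀(t) Y₀(s))` solves the normal form, vanishes at
`s = t`, and has slope `-2 / π` there by the Wronskian. -/
lemma phase_determinant_lower {s t : ℝ} (ht : 7 ≤ t) (hts : t ≤ s) (hst : s - t ≤ Real.pi / 2) :
    2 / Real.pi * (2 / Real.pi - 1 / 196) * (s - t) ≤
      √s * √t * |besselJ0 s * besselY0 t - besselJ0 t * besselY0 s| := by
  have ht0 : 0 < t := by linarith
  have hsq : 0 < √t := Real.sqrt_pos.2 ht0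
  have h := (isLiouvilleSolution_J.mul_sub_mul isLiouvilleSolution_Y (√t * besselY0 t)
    (√t * besselJ0 t)).abs_sub_sin_le ht0 hts (by ring)
  have hW : (eulerJ t + besselJ0 t / 2) / √t * (√t * besselY0 t)
      - (eulerY t + besselY0 t / 2) / √t * (√t * besselJ0 t) = -(2 / Real.pi) := by
    rw [← bessel_wronskian ht0]
    field_simp
    ring
  have hpi : 0 < 2 / Real.pi := by positivity
  simp only [hW, abs_neg, abs_of_pos hpi] at h
  have hv : √s * besselJ0 s * (√t * besselY0 t) - √s * besselY0 s * (√t * besselJ0 t)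
      = √s * √t * (besselJ0 s * besselY0 t - besselJ0 t * besselY0 s) := by ring
  rw [hv] at h
  have hsin : 2 / Real.pi * (s - t) ≤ Real.sin (s - t) :=
    Real.mul_le_sin (by linarith) hst
  have herr : 2 / Real.pi / (4 * t ^ 2) * (s - t) ≤ 2 / Real.pi * (1 / 196) * (s - t) := by
    have : 1 / (4 * t ^ 2) ≤ 1 / 196 := one_div_le_one_div_of_le (by norm_num) (by nlinarith)
    rw [div_eq_mul_one_div]
    gcongr
  have habs : √s * √t * |besselJ0 s * besselY0 t - besselJ0 t * besselY0 s|
      = |√s * √t * (besselJ0 s * besselY0 t - besselJ0 t * besselY0 s)| := by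
    rw [abs_mul, abs_of_nonneg (by positivity : 0 ≤ √s * √t)]
  rw [habs]
  have h1 := (abs_le.1 h).2
  have h2 := neg_abs_le (√s * √t * (besselJ0 s * besselY0 t - besselJ0 t * besselY0 s))
  have h3 : 2 / Real.pi * (2 / Real.pi * (s - t)) ≤ 2 / Real.pi * Real.sin (s - t) := by gcongr
  linarith

/-! ### Uniform lower bound for the determinant on the arc -/

lemma norm_polar_sub_sq (R θ ρ φ : ℝ) :
    ‖polar R θ - polar ρ φ‖ ^ 2 = R ^ 2 + ρ ^ 2 - 2 * R * ρ * Real.cos (θ - φ) := by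
  rw [EuclideanSpace.norm_sq_eq, Fin.sum_univ_two, Real.cos_sub]
  simp only [polar, PiLp.sub_apply, Real.norm_eq_abs, sq_abs, Matrix.cons_val_zero,
    Matrix.cons_val_one]
  linear_combination R ^ 2 * Real.sin_sq_add_cos_sq θ + ρ ^ 2 * Real.sin_sq_add_cos_sq φ

lemma cos_sub_center_ge {m j : ℕ} (hm : 10 ≤ m) {θ : ℝ} (hθ : θ ∈ arcAngles m j) :
    0.95 ≤ Real.cos (θ - nu m (2 * (j : ℝ) - 1)) := by
  have hm' : (10 : ℝ) ≤ m := by exact_mod_cast hm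
  have hm0 : (0 : ℝ) < m := by linarith
  have hstep : Real.pi / m ≤ Real.pi / 10 := by gcongr
  obtain ⟨h1, h2⟩ := hθ
  have e1 : nu m (2 * (j : ℝ) - 2) = nu m (2 * (j : ℝ) - 1) - Real.pi / m := by
    unfold nu; field_simp; ring
  have e2 : nu m (2 * (j : ℝ)) = nu m (2 * (j : ℝ) - 1) + Real.pi / m := by
    unfold nu; field_simp; ring
  have hsq : (θ - nu m (2 * (j : ℝ) - 1)) ^ 2 ≤ 0.315 ^ 2 :=
    sq_le_sq' (by linarith [Real.pi_lt_d2]) (by linarith [Real.pi_lt_d2])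
  have := Real.one_sub_sq_div_two_le_cos (x := θ - nu m (2 * (j : ℝ) - 1))
  linarith

/-- Geometry for large wavenumbers: with `K = k R` and `c` the cosine of the angle to the centre of
the arc, the scaled distances `s`, `t` to the two reference points vary little along the arc and
differ by almost a quarter period. -/
lemma scaled_distances_large {K l c s t : ℝ} (hK : 6 * Real.pi ≤ K)
    (hl : l = 1 / 2 + Real.pi / (2 * K)) (hc : 0.95 ≤ c) (hc1 : c ≤ 1) (hs0 : 0 ≤ s) (ht0 : 0 ≤ t)
    (hs : s ^ 2 = K ^ 2 * (5 / 4 - c)) (ht : t ^ 2 = K ^ 2 * (1 + l ^ 2 - 2 * l * c)) :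
    K / 2 ≤ s ∧ K * (1 - l) ≤ t ∧ 7 ≤ K * (1 - l) ∧ t ≤ s ∧ s - t ≤ Real.pi / 2 ∧
      0.74 * (Real.pi / 2) ≤ s - t ∧ s * t ≤ 1.27 * (K / 2 * (K * (1 - l))) := by
  have hpi := Real.pi_gt_d2
  have hK0 : 0 < K := by linarith
  obtain ⟨d, hd⟩ : ∃ d, d = Real.pi / (2 * K) := ⟨_, rfl⟩
  have hKd : K * d = Real.pi / 2 := by rw [hd]; field_simp
  have hd0 : 0 < d := by rw [hd]; positivity
  have hd1 : d ≤ 1 / 12 := by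
    rw [hd, div_le_div_iff₀ (by positivity) (by norm_num)]; linarith
  rw [← hd] at hl
  subst hl
  have hK2 : 0 < K ^ 2 := by positivity
  have b1 : K / 2 ≤ s := by
    refine le_of_sq_le_sq ?_ hs0
    rw [hs]; nlinarith
  have b2 : K * (1 - (1 / 2 + d)) ≤ t := by
    refine le_of_sq_le_sq ?_ ht0
    rw [ht, mul_pow]
    refine mul_le_mul_of_nonneg_left ?_ hK2.le
    nlinarith
  have b3 : 7 ≤ K * (1 - (1 / 2 + d)) := by nlinarith
  have hdiff : (s - t) * (s + t) = Real.pi / 2 * (K * (2 * c - 1 - d)) := by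
    rw [← hKd]
    linear_combination hs - ht
  have hpos : 0 < s + t := by linarith
  have b4 : t ≤ s := by
    have : 0 ≤ (s - t) * (s + t) := by
      rw [hdiff]
      exact mul_nonneg (by linarith) (mul_nonneg hK0.le (by linarith))
    linarith [nonneg_of_mul_nonneg_left this hpos]
  have b5 : s - t ≤ Real.pi / 2 := by
    refine le_of_mul_le_mul_right ?_ hpos
    rw [hdiff]
    refine mul_le_mul_of_nonneg_left ?_ (by linarith)
    nlinarith
  have b6 : s ≤ 0.5478 * K := by
    refine le_of_sq_le_sq ?_ (by positivity)
    rw [hs]; nlinarith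
  have b7 : 0.74 * (Real.pi / 2) ≤ s - t := by
    refine le_of_mul_le_mul_right ?_ hpos
    rw [hdiff, mul_comm (0.74 : ℝ), mul_assoc]
    refine mul_le_mul_of_nonneg_left ?_ (by linarith)
    nlinarith
  refine ⟨b1, b2, b3, b4, b5, b7, ?_⟩
  have e1 : s ^ 2 ≤ 1.2 * (K / 2) ^ 2 := by rw [hs]; nlinarith
  have e2 : t ^ 2 ≤ 1.34 * (K * (1 - (1 / 2 + d))) ^ 2 := by
    rw [ht, mul_pow, mul_left_comm]
    refine mul_le_mul_of_nonneg_left ?_ hK2.le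
    nlinarith
  refine le_of_sq_le_sq ?_ (by nlinarith)
  calc (s * t) ^ 2 = s ^ 2 * t ^ 2 := mul_pow _ _ _
    _ ≤ (1.2 * (K / 2) ^ 2) * (1.34 * (K * (1 - (1 / 2 + d))) ^ 2) := by gcongr
    _ = 1.608 * (K / 2 * (K * (1 - (1 / 2 + d)))) ^ 2 := by ring
    _ ≤ 1.6129 * (K / 2 * (K * (1 - (1 / 2 + d)))) ^ 2 := by gcongr; norm_num
    _ = _ := by ring

/-- From an amplitude bound at `s ≥ s₀`, `t ≥ t₀` and the phase determinant, a lower bound for the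
determinant relative to uniform bounds of the amplitudes. -/
lemma determinant_bound_large {s t s₀ t₀ : ℝ} (ht₀ : 7 ≤ t₀) (hs₀ : 0 < s₀) (htt : t₀ ≤ t)
    (hts : t ≤ s) (hst : s - t ≤ Real.pi / 2) (hst' : 0.74 * (Real.pi / 2) ≤ s - t)
    (hprod : s * t ≤ 1.27 * (s₀ * t₀)) :
    √(1.4 / s₀) * √(1.4 / t₀) ≤
      3.6 * |besselJ0 s * besselY0 t - besselJ0 t * besselY0 s| := by
  have ht0 : 0 < t₀ := by linarith
  have hD := phase_determinant_lower (ht₀.trans htt) hts hst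
  set D := |besselJ0 s * besselY0 t - besselJ0 t * besselY0 s| with hDdef
  have hD0 : 0 ≤ D := abs_nonneg _
  have hL : 0.465 ≤ √s * √t * D := by
    refine le_trans ?_ hD
    have hp : 0.634 ≤ 2 / Real.pi := by
      rw [le_div_iff₀ Real.pi_pos]; linarith [Real.pi_lt_d2]
    calc (0.465 : ℝ) ≤ 0.74 * (0.634 - 1 / 196) := by norm_num
      _ ≤ 0.74 * (2 / Real.pi - 1 / 196) := by gcongr
      _ = 2 / Real.pi * (2 / Real.pi - 1 / 196) * (0.74 * (Real.pi / 2)) := by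
        field_simp
      _ ≤ _ := by
        refine mul_le_mul_of_nonneg_left hst' (mul_nonneg (by positivity) (by linarith))
  have hq : √s * √t ≤ 1.127 * (√s₀ * √t₀) := by
    rw [← Real.sqrt_mul (by linarith), ← Real.sqrt_mul hs₀.le]
    refine Real.sqrt_le_iff.2 ⟨by positivity, ?_⟩
    rw [mul_pow, Real.sq_sqrt (by positivity)]
    nlinarith [mul_pos hs₀ ht0]
  have hr : 0 < √s₀ * √t₀ := by positivity
  have e : √(1.4 / s₀) * √(1.4 / t₀) = 1.4 / (√s₀ * √t₀) := by
    rw [Real.sqrt_div (by norm_num), Real.sqrt_div (by norm_num), div_mul_div_comm,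
      Real.mul_self_sqrt (by norm_num)]
  rw [e, div_le_iff₀ hr]
  have : √s * √t * D ≤ 1.127 * (√s₀ * √t₀) * D := by gcongr
  nlinarith

lemma hankel_sq_le_of_le {s s₀ : ℝ} (h2 : 2 ≤ s₀) (h : s₀ ≤ s) :
    besselJ0 s ^ 2 + besselY0 s ^ 2 ≤ √(1.4 / s₀) ^ 2 := by
  have hs0 : 0 < s₀ := by linarith
  rw [Real.sq_sqrt (by positivity), le_div_iff₀ hs0]
  have := hankel_amplitude (h2.trans h)
  nlinarith [sq_nonneg (besselJ0 s), sq_nonneg (besselY0 s)]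

lemma two_div_pi_mem : 0.634 ≤ 2 / Real.pi ∧ 2 / Real.pi ≤ 0.637 := by
  constructor
  · rw [le_div_iff₀ Real.pi_pos]; linarith [Real.pi_lt_d2]
  · rw [div_le_iff₀ Real.pi_pos]; linarith [Real.pi_gt_d4]

lemma bessel_near_one_third {s : ℝ} (h1 : 0.314 ≤ s) (h2 : s ≤ 0.3445) :
    0.95 ≤ besselJ0 s ∧ besselJ0 s ≤ 1 ∧ -0.9 ≤ besselY0 s ∧ besselY0 s ≤ -0.6 := by
  obtain ⟨x, hx⟩ : ∃ x, x = s ^ 2 / 4 := ⟨_, rfl⟩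
  have hx1 : 0.0246 ≤ x := by rw [hx]; nlinarith
  have hx2 : x ≤ 0.0297 := by rw [hx]; nlinarith
  have hJ := abs_le.1 (abs_besselJ0_sub_le hx (by linarith))
  have hS := abs_le.1 (abs_besselS_sub_le hx (by linarith))
  have x0 : 0 ≤ x := by linarith
  have p2 : x ^ 2 ≤ 0.0297 ^ 2 := by gcongr
  have p3 : x ^ 3 ≤ 0.0297 ^ 3 := by gcongr
  have p4 : x ^ 4 ≤ 0.0297 ^ 4 := by gcongr
  have p5 : x ^ 5 ≤ 0.0297 ^ 5 := by gcongr
  have q2 : 0 ≤ x ^ 2 := by positivity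
  have q3 : 0 ≤ x ^ 3 := by positivity
  have q4 : 0 ≤ x ^ 4 := by positivity
  have q5 : 0 ≤ x ^ 5 := by positivity
  have hJ1 : 0.96 ≤ besselJ0 s := by linarith
  have hJ2 : besselJ0 s ≤ 0.98 := by linarith
  have hS1 : -0.031 ≤ besselS s := by linarith
  have hS2 : besselS s ≤ -0.023 := by linarith
  -- `log (s / 2) = log (4 s) - 3 log 2`, and `4 s` is close to `1`
  have hlog : Real.log (s / 2) = Real.log (4 * s) - 3 * Real.log 2 := by
    have e8 : s / 2 = 4 * s / 2 ^ 3 := by ring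
    rw [e8, Real.log_div (by positivity) (by positivity), Real.log_pow]
    norm_num
  have hl1 := Real.one_sub_inv_le_log_of_pos (by positivity : 0 < 4 * s)
  have hl2 := Real.log_le_sub_one_of_pos (by positivity : 0 < 4 * s)
  have hl3 : (4 * s)⁻¹ ≤ 0.797 := by
    rw [inv_le_comm₀ (by positivity) (by norm_num)]; norm_num; linarith
  have hg1 := Real.one_half_lt_eulerMascheroniConstant
  have hg2 := Real.eulerMascheroniConstant_lt_two_thirds
  have k1 := Real.log_two_gt_d9
  have k2 := Real.log_two_lt_d9
  obtain ⟨c, hc⟩ : ∃ c, c = -(Real.log (s / 2) + Real.eulerMascheroniConstant) := ⟨_, rfl⟩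
  have hc1 : 1.03 ≤ c := by linarith
  have hc2 : c ≤ 1.38 := by linarith
  have hY : besselY0 s = -(2 / Real.pi * (c * besselJ0 s + besselS s)) := by
    rw [besselY0_eq, hc]; ring
  obtain ⟨hp1, hp2⟩ := two_div_pi_mem
  have m1 : 1.03 * 0.96 ≤ c * besselJ0 s := by gcongr
  have m2 : c * besselJ0 s ≤ 1.38 * 0.98 := by gcongr
  have m3 : 0.634 * 0.955 ≤ 2 / Real.pi * (c * besselJ0 s + besselS s) := by gcongr; linarith
  have m4 : 2 / Real.pi * (c * besselJ0 s + besselS s) ≤ 0.637 * 1.34 := by gcongr <;> linarith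
  rw [hY]
  refine ⟨?_, ?_, ?_, ?_⟩ <;> linarith

lemma bessel_near_half_pi {t : ℝ} (h1 : 1.55 ≤ t) (h2 : t ≤ 1.571) :
    0.4 ≤ besselJ0 t ∧ besselJ0 t ≤ 0.55 ∧ 0.3 ≤ besselY0 t ∧ besselY0 t ≤ 0.5 := by
  obtain ⟨x, hx⟩ : ∃ x, x = t ^ 2 / 4 := ⟨_, rfl⟩
  have hx1 : 0.6 ≤ x := by rw [hx]; nlinarith
  have hx2 : x ≤ 0.6171 := by rw [hx]; nlinarith
  have hJ := abs_le.1 (abs_besselJ0_sub_le hx (by linarith))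
  have hS := abs_le.1 (abs_besselS_sub_le hx (by linarith))
  have x0 : 0 ≤ x := by linarith
  have p2 : x ^ 2 ≤ 0.6171 ^ 2 := by gcongr
  have p3 : x ^ 3 ≤ 0.6171 ^ 3 := by gcongr
  have p4 : x ^ 4 ≤ 0.6171 ^ 4 := by gcongr
  have p5 : x ^ 5 ≤ 0.6171 ^ 5 := by gcongr
  have q2 : 0.6 ^ 2 ≤ x ^ 2 := by gcongr
  have q3 : 0.6 ^ 3 ≤ x ^ 3 := by gcongr
  have q4 : 0.6 ^ 4 ≤ x ^ 4 := by gcongr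
  have q5 : 0.6 ^ 5 ≤ x ^ 5 := by gcongr
  have hJ1 : 0.46 ≤ besselJ0 t := by linarith
  have hJ2 : besselJ0 t ≤ 0.5 := by linarith
  have hS1 : -0.5 ≤ besselS t := by linarith
  have hS2 : besselS t ≤ -0.46 := by linarith
  have hl1 := Real.one_sub_inv_le_log_of_pos (by positivity : 0 < t / 2)
  have hl2 := Real.log_le_sub_one_of_pos (by positivity : 0 < t / 2)
  have hl3 : (t / 2)⁻¹ ≤ 1.3 := by
    rw [inv_le_comm₀ (by positivity) (by norm_num)]; norm_num; linarith
  have hg1 := Real.one_half_lt_eulerMascheroniConstant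
  have hg2 := Real.eulerMascheroniConstant_lt_two_thirds
  obtain ⟨c, hc⟩ : ∃ c, c = Real.log (t / 2) + Real.eulerMascheroniConstant := ⟨_, rfl⟩
  have hc1 : 0.2 ≤ c := by linarith
  have hc2 : c ≤ 0.46 := by linarith
  have hY : besselY0 t = 2 / Real.pi * (c * besselJ0 t - besselS t) := by
    rw [besselY0_eq, hc]
  obtain ⟨hp1, hp2⟩ := two_div_pi_mem
  have m1 : 0.2 * 0.46 ≤ c * besselJ0 t := by gcongr
  have m2 : c * besselJ0 t ≤ 0.46 * 0.5 := by gcongr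
  have m3 : 0.634 * 0.55 ≤ 2 / Real.pi * (c * besselJ0 t - besselS t) := by gcongr; linarith
  have m4 : 2 / Real.pi * (c * besselJ0 t - besselS t) ≤ 0.637 * 0.73 := by gcongr <;> linarith
  rw [hY]
  refine ⟨?_, ?_, ?_, ?_⟩ <;> linarith

lemma det_matA (a τ k : ℝ) (m j : ℕ) (x : Plane) :
    (matA a τ k m j x).det = Jref a τ k m j 0 x * Yref a τ k m j 1 x
      - Jref a τ k m j 1 x * Yref a τ k m j 0 x := by
  rw [matA, Matrix.det_fin_two_of]; ring

lemma scaled_refDist_sq (a τ k : ℝ) (m j : ℕ) (l : Fin 2) (θ : ℝ) :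
    (k * refDist a τ k m j l (polar (radius a τ k) θ)) ^ 2 =
      (k * radius a τ k) ^ 2 * (1 + lam a τ k l ^ 2
        - 2 * lam a τ k l * Real.cos (θ - nu m (2 * (j : ℝ) - 1))) := by
  rw [refDist, refPoint, mul_pow, norm_polar_sub_sq]; ring

/-- The quantitative core: on the arc, the determinant is comparable with the product of uniform
bounds `B 0`, `B 1` for the moduli of the two Hankel functions. -/
lemma exists_amplitude_bounds {a τ k : ℝ} {m : ℕ} (ha : 0 < a) (hτ : 6 ≤ τ) (hm : 10 ≤ m)
    (hk : k ∈ admissible a) (j : ℕ) :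
    ∃ B : Fin 2 → ℝ, (∀ l, 0 < B l) ∧ ∀ x ∈ arc (radius a τ k) m j,
      (∀ l, Jref a τ k m j l x ^ 2 + Yref a τ k m j l x ^ 2 ≤ B l ^ 2) ∧
      B 0 * B 1 ≤ 3.6 * |(matA a τ k m j x).det| := by
  have hpi := Real.pi_pos
  have hl0 : lam a τ k 0 = 1 / 2 := rfl
  by_cases hks : k = kStar a
  · have hR : radius a τ k = 6 * a := if_pos hks
    have hl1 : lam a τ k 1 = -(3 / 2) := by simp [lam, hks]
    have hk0 : 0 < k := by rw [hks, kStar]; positivity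
    have hK : k * radius a τ k = Real.pi / 5 := by
      rw [hR, hks, kStar]; field_simp; norm_num
    have hK1 : 0.628 ≤ Real.pi / 5 := by linarith [Real.pi_gt_d2]
    have hK2 : Real.pi / 5 ≤ 0.6284 := by linarith [Real.pi_lt_d4]
    have hKs1 : 0.628 ^ 2 ≤ (Real.pi / 5) ^ 2 := by gcongr
    have hKs2 : (Real.pi / 5) ^ 2 ≤ 0.6284 ^ 2 := by gcongr
    refine ⟨![1.35, 0.75], fun l => by fin_cases l <;> norm_num, ?_⟩
    rintro _ ⟨θ, hθ, rfl⟩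
    have hs := scaled_refDist_sq a τ k m j 0 θ
    have ht := scaled_refDist_sq a τ k m j 1 θ
    have hc := cos_sub_center_ge hm hθ
    have hc1 := Real.cos_le_one (θ - nu m (2 * (j : ℝ) - 1))
    have hs0 : 0 ≤ k * refDist a τ k m j 0 (polar (radius a τ k) θ) :=
      mul_nonneg hk0.le (norm_nonneg _)
    have ht0 : 0 ≤ k * refDist a τ k m j 1 (polar (radius a τ k) θ) :=
      mul_nonneg hk0.le (norm_nonneg _)
    rw [det_matA, Fin.forall_fin_two]
    unfold Jref Yref
    rw [hK, hl0] at hs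
    rw [hK, hl1] at ht
    generalize k * refDist a τ k m j 0 (polar (radius a τ k) θ) = s at *
    generalize k * refDist a τ k m j 1 (polar (radius a τ k) θ) = t at *
    generalize Real.cos (θ - nu m (2 * (j : ℝ) - 1)) = c at *
    obtain ⟨u1, u2, u3, u4⟩ := bessel_near_one_third (s := s)
      (le_of_sq_le_sq (by rw [hs]; nlinarith) hs0)
      (le_of_sq_le_sq (by rw [hs]; nlinarith) (by norm_num))
    obtain ⟨v1, v2, v3, v4⟩ := bessel_near_half_pi (t := t)
      (le_of_sq_le_sq (by rw [ht]; nlinarith) ht0)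
      (le_of_sq_le_sq (by rw [ht]; nlinarith) (by norm_num))
    simp only [Matrix.cons_val_zero, Matrix.cons_val_one]
    refine ⟨⟨by nlinarith, by nlinarith⟩, ?_⟩
    refine le_trans ?_ (mul_le_mul_of_nonneg_left (le_abs_self _) (by norm_num))
    have w1 : 0.95 * 0.3 ≤ besselJ0 s * besselY0 t := by gcongr
    have w2 : 0.4 * 0.6 ≤ besselJ0 t * -besselY0 s := by gcongr; linarith
    linarith
  · obtain ⟨x, hx, hkx⟩ : ∃ x : ℝ, 1 ≤ x ∧ k = Real.pi / a * x := hk.resolve_right hks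
    have hR : radius a τ k = τ * a := if_neg hks
    have hl1 : lam a τ k 1 = 1 / 2 + Real.pi / (2 * (k * radius a τ k)) := by
      simp [lam, hks, mul_assoc]
    have hk0 : 0 < k := by rw [hkx]; positivity
    have hK : 6 * Real.pi ≤ k * radius a τ k := by
      have : k * radius a τ k = τ * x * Real.pi := by rw [hR, hkx]; field_simp
      rw [this]
      gcongr
      nlinarith
    have hKpos : 0 < k * radius a τ k := by linarith
    have hlow : 7 ≤ k * radius a τ k * (1 - lam a τ k 1) := by
      have : k * radius a τ k * (1 - lam a τ k 1) = k * radius a τ k / 2 - Real.pi / 2 := by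
        rw [hl1]
        generalize k * radius a τ k = K at hKpos ⊢
        field_simp
        ring
      linarith [Real.pi_gt_d2]
    refine ⟨![√(1.4 / (k * radius a τ k / 2)), √(1.4 / (k * radius a τ k * (1 - lam a τ k 1)))],
      fun l => ?_, ?_⟩
    · have h7 : 0 < k * radius a τ k * (1 - lam a τ k 1) := by linarith
      fin_cases l <;> exact Real.sqrt_pos.2 (div_pos (by norm_num) (by first | exact h7 | linarith))
    rintro _ ⟨θ, hθ, rfl⟩
    have hs := scaled_refDist_sq a τ k m j 0 θ
    have ht := scaled_refDist_sq a τ k m j 1 θ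
    have hs0 : 0 ≤ k * refDist a τ k m j 0 (polar (radius a τ k) θ) :=
      mul_nonneg hk0.le (norm_nonneg _)
    have ht0 : 0 ≤ k * refDist a τ k m j 1 (polar (radius a τ k) θ) :=
      mul_nonneg hk0.le (norm_nonneg _)
    obtain ⟨g1, g2, g3, g4, g5, g6, g7⟩ := scaled_distances_large hK hl1 (cos_sub_center_ge hm hθ)
      (Real.cos_le_one _) hs0 ht0 (by rw [hs, hl0]; ring) ht
    rw [det_matA, Fin.forall_fin_two]
    simp only [Matrix.cons_val_zero, Matrix.cons_val_one]
    exact ⟨⟨hankel_sq_le_of_le (by linarith [Real.pi_gt_d2]) g1,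
      hankel_sq_le_of_le (by linarith) g2⟩,
      determinant_bound_large g3 (by linarith) g2 g4 g5 g6 g7⟩

/-! ### Essential suprema over the arc -/

lemma ae_norm_le_of_linf_le {F : Type*} [NormedAddCommGroup F] {R : ℝ} {m j : ℕ} {f : Plane → F}
    {C : ℝ} (hC : 0 ≤ C) (h : linf R m j f ≤ ENNReal.ofReal C) :
    ∀ᵐ x ∂arcMeasure R m j, ‖f x‖ ≤ C := by
  rw [linf, eLpNorm_exponent_top] at h
  filter_upwards [enorm_ae_le_eLpNormEssSup f (arcMeasure R m j)] with x hx
  have := hx.trans h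
  rwa [← ofReal_norm, ENNReal.ofReal_le_ofReal_iff hC] at this

lemma linf_le_of_ae_norm_le {F : Type*} [NormedAddCommGroup F] {R : ℝ} {m j : ℕ} {f : Plane → F}
    {C : ℝ} (h : ∀ᵐ x ∂arcMeasure R m j, ‖f x‖ ≤ C) : linf R m j f ≤ ENNReal.ofReal C := by
  rw [linf, eLpNorm_exponent_top]
  exact eLpNormEssSup_le_of_ae_bound h

lemma ae_norm_le_toReal_linf {F : Type*} [NormedAddCommGroup F] {R : ℝ} {m j : ℕ} {f : Plane → F}
    (h : linf R m j f ≠ ∞) : ∀ᵐ x ∂arcMeasure R m j, ‖f x‖ ≤ (linf R m j f).toReal :=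
  ae_norm_le_of_linf_le ENNReal.toReal_nonneg (ENNReal.ofReal_toReal h).ge

lemma toReal_linf_le {F : Type*} [NormedAddCommGroup F] {R : ℝ} {m j : ℕ} {f : Plane → F}
    {C : ℝ} (hC : 0 ≤ C) (h : ∀ᵐ x ∂arcMeasure R m j, ‖f x‖ ≤ C) : (linf R m j f).toReal ≤ C :=
  ENNReal.toReal_le_of_le_ofReal hC (linf_le_of_ae_norm_le h)

lemma linf_ne_top {F : Type*} [NormedAddCommGroup F] {R : ℝ} {m j : ℕ} {f : Plane → F}
    {C : ℝ} (h : ∀ᵐ x ∂arcMeasure R m j, ‖f x‖ ≤ C) : linf R m j f ≠ ∞ :=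
  ((linf_le_of_ae_norm_le h).trans_lt ENNReal.ofReal_lt_top).ne

lemma continuous_polar (R : ℝ) : Continuous (polar R) := by
  unfold polar
  refine (PiLp.continuous_toLp 2 _).comp (continuous_pi fun i => ?_)
  fin_cases i
  · exact continuous_const.mul Real.continuous_cos
  · exact continuous_const.mul Real.continuous_sin

lemma ae_mem_arc (R : ℝ) (m j : ℕ) : ∀ᵐ x ∂arcMeasure R m j, x ∈ arc R m j := by
  have hmeas : MeasurableSet (arc R m j) :=
    (isCompact_Icc.image (continuous_polar R)).isClosed.measurableSet
  refine Measure.ae_smul_measure ?_ _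
  refine (ae_map_iff (continuous_polar R).measurable.aemeasurable hmeas).2 ?_
  filter_upwards [ae_restrict_mem measurableSet_Icc] with θ hθ
  exact Set.mem_image_of_mem _ hθ

lemma arcMeasure_ne_zero {R : ℝ} {m : ℕ} (hR : 0 < R) (hm : 0 < m) (j : ℕ) :
    arcMeasure R m j ≠ 0 := by
  have hm' : (0 : ℝ) < m := by exact_mod_cast hm
  have hlt : nu m (2 * (j : ℝ) - 2) < nu m (2 * (j : ℝ)) := by
    unfold nu
    gcongr
    linarith
  rw [Ne, ← Measure.measure_univ_eq_zero, arcMeasure, Measure.smul_apply, smul_eq_mul,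
    Measure.map_apply (continuous_polar R).measurable MeasurableSet.univ, Set.preimage_univ,
    Measure.restrict_apply_univ, arcAngles, Real.volume_Icc]
  exact mul_ne_zero (ENNReal.ofReal_pos.2 hR).ne' (ENNReal.ofReal_pos.2 (by linarith)).ne'

/-! ### Means of the radiated fields -/

lemma integrable_wienerIntegral {Ω : Type*} [MeasurableSpace Ω] {P : Measure Ω}
    [IsProbabilityMeasure P] (W : Lp ℝ 2 (volume : Measure Plane) →ₗ[ℝ] Lp ℝ 2 P)
    (D : Set Plane) (h : Plane → ℝ) : Integrable (wienerIntegral W D h) P := by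
  unfold wienerIntegral
  split_ifs with hh
  · exact (Lp.memLp _).integrable one_le_two
  · exact integrable_zero _ _ _

lemma IsMildSolution.integrable {Ω : Type*} [MeasurableSpace Ω] {P : Measure Ω}
    [IsProbabilityMeasure P] {W : Lp ℝ 2 (volume : Measure Plane) →ₗ[ℝ] Lp ℝ 2 P}
    {a k : ℝ} {g σ : Plane → ℝ} {u : Plane → Ω → ℂ} (hu : IsMildSolution P W a k g σ u)
    (x : Plane) : Integrable (u x) P :=
  (((integrable_const _).add (integrable_wienerIntegral W _ _).ofReal).add
    ((integrable_wienerIntegral W _ _).ofReal.const_mul Complex.I)).congr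
    ((hu.eq_integral x).mono fun _ h => h.symm)

lemma mean_vHat {Ω : Type*} [MeasurableSpace Ω] {P : Measure Ω} [IsProbabilityMeasure P]
    {a τ k : ℝ} {m j : ℕ} {pu : Plane → ℝ} {u : Plane → Ω → ℂ} {l : Fin 2} {x : Plane}
    (hu : Integrable (u x) P) : mean P (vHat a τ k m j pu u l) x =
      mean P u x + (scaling a τ k m j pu l : ℂ) * green k x (refPoint a τ k m j l) := by
  simp only [mean, vHat]
  rw [integral_add hu (integrable_const _)]
  simp

/-! ### Stability of the recovery -/

lemma norm_hankel0_sq (t : ℝ) : ‖hankel0 t‖ ^ 2 = besselJ0 t ^ 2 + besselY0 t ^ 2 := by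
  rw [hankel0, mul_comm, ← Complex.normSq_eq_norm_sq, Complex.normSq_add_mul_I]

lemma norm_green (a τ k : ℝ) (m j : ℕ) (l : Fin 2) (x : Plane) :
    ‖green k x (refPoint a τ k m j l)‖ = ‖hankel0 (k * refDist a τ k m j l x)‖ / 4 := by
  rw [green, norm_mul, norm_neg, norm_div, Complex.norm_I, refDist]
  norm_num
  ring

/-- The polarization identity behind the recovery: the squared moduli of a number `U` and of its
translate by the reference wave determine a real linear functional of `U`. -/
lemma polarization {c : ℝ} (hc : c ≠ 0) (U : ℂ) (t : ℝ) :
    2 / c * (‖U + (c : ℂ) * (-(Complex.I / 4) * hankel0 t)‖ ^ 2 - ‖U‖ ^ 2)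
      - c / 8 * ‖hankel0 t‖ ^ 2 = besselY0 t * U.re - besselJ0 t * U.im := by
  rw [norm_hankel0_sq, ← Complex.normSq_eq_norm_sq, ← Complex.normSq_eq_norm_sq,
    Complex.normSq_apply, Complex.normSq_apply, hankel0]
  simp only [Complex.add_re, Complex.add_im, Complex.mul_re, Complex.mul_im, Complex.neg_re,
    Complex.neg_im, Complex.ofReal_re, Complex.ofReal_im, Complex.I_re, Complex.I_im,
    Complex.div_ofNat_re, Complex.div_ofNat_im]
  field_simp
  ring

/-- Cramer's rule for the perturbed system: the error is a combination of the two Hankel values,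
weighted by the errors of the opposite right-hand sides. -/
lemma norm_cramer_sub_le {J₀ Y₀ J₁ Y₁ f₀ f₁ δ₀ δ₁ b₀ b₁ : ℝ} {U : ℂ}
    (hD : J₀ * Y₁ - J₁ * Y₀ ≠ 0)
    (h0 : |f₀ - (Y₀ * U.re - J₀ * U.im)| ≤ δ₀) (h1 : |f₁ - (Y₁ * U.re - J₁ * U.im)| ≤ δ₁)
    (hb0 : J₀ ^ 2 + Y₀ ^ 2 ≤ b₀ ^ 2) (hb1 : J₁ ^ 2 + Y₁ ^ 2 ≤ b₁ ^ 2)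
    (hb0' : 0 ≤ b₀) (hb1' : 0 ≤ b₁) :
    ‖(((!![f₀, -J₀; f₁, -J₁].det / !![Y₀, -J₀; Y₁, -J₁].det : ℝ) : ℂ)
      + Complex.I * ((!![Y₀, f₀; Y₁, f₁].det / !![Y₀, -J₀; Y₁, -J₁].det : ℝ) : ℂ)) - U‖
      ≤ (δ₁ * b₀ + δ₀ * b₁) / |J₀ * Y₁ - J₁ * Y₀| := by
  obtain ⟨e₀, he0⟩ : ∃ e, e = f₀ - (Y₀ * U.re - J₀ * U.im) := ⟨_, rfl⟩
  obtain ⟨e₁, he1⟩ : ∃ e, e = f₁ - (Y₁ * U.re - J₁ * U.im) := ⟨_, rfl⟩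
  rw [← he0] at h0
  rw [← he1] at h1
  have hd : Matrix.det !![Y₀, -J₀; Y₁, -J₁] = J₀ * Y₁ - J₁ * Y₀ := by
    rw [Matrix.det_fin_two_of]; ring
  have hnorm : ∀ {J Y b : ℝ}, J ^ 2 + Y ^ 2 ≤ b ^ 2 → 0 ≤ b → ‖(⟨J, Y⟩ : ℂ)‖ ≤ b := by
    intro J Y b h hb
    refine le_of_sq_le_sq ?_ hb
    rw [← Complex.normSq_eq_norm_sq, Complex.normSq_mk]
    linarith
  have key : (((!![f₀, -J₀; f₁, -J₁].det / !![Y₀, -J₀; Y₁, -J₁].det : ℝ) : ℂ)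
      + Complex.I * ((!![Y₀, f₀; Y₁, f₁].det / !![Y₀, -J₀; Y₁, -J₁].det : ℝ) : ℂ)) - U
      = ((e₁ : ℂ) * ⟨J₀, Y₀⟩ - (e₀ : ℂ) * ⟨J₁, Y₁⟩) / ((J₀ * Y₁ - J₁ * Y₀ : ℝ) : ℂ) := by
    rw [hd, Matrix.det_fin_two_of, Matrix.det_fin_two_of]
    apply Complex.ext
    · rw [Complex.div_ofReal_re]
      simp only [Complex.sub_re, Complex.add_re, Complex.mul_re, Complex.ofReal_re,
        Complex.ofReal_im, Complex.I_re, Complex.I_im]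
      rw [he0, he1]
      field_simp
      ring
    · rw [Complex.div_ofReal_im]
      simp only [Complex.sub_im, Complex.add_im, Complex.mul_im, Complex.ofReal_re,
        Complex.ofReal_im, Complex.I_re, Complex.I_im, zero_mul, one_mul, zero_add, mul_zero,
        add_zero]
      rw [he0, he1, div_sub' hD]
      congr 1
      ring
  rw [key, norm_div, Complex.norm_real, Real.norm_eq_abs]
  have hδ0 := (abs_nonneg _).trans h0
  have hδ1 := (abs_nonneg _).trans h1
  gcongr
  refine (norm_sub_le _ _).trans ?_
  rw [norm_mul, norm_mul, Complex.norm_real, Complex.norm_real, Real.norm_eq_abs, Real.norm_eq_abs]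
  gcongr
  exacts [hnorm hb0 hb0', hnorm hb1 hb1']

lemma abs_sq_sub_sq_le {p q N δ : ℝ} (hp : 0 ≤ p) (hq : 0 ≤ q) (hqN : q ≤ N) (h : |p - q| ≤ δ) :
    |p ^ 2 - q ^ 2| ≤ δ * (2 * N + δ) := by
  have hpN := (abs_le.1 h).2
  have hδ := (abs_nonneg _).trans h
  calc |p ^ 2 - q ^ 2| = |p - q| * (p + q) := by
        rw [sq_sub_sq, abs_mul, abs_of_nonneg (by positivity : 0 ≤ p + q), mul_comm]
    _ ≤ δ * (2 * N + δ) :=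
        mul_le_mul h (by linarith) (by positivity) hδ

/-- The perturbed right-hand side, for a scaling factor `c = p / G` with `p` comparable to the size
`M` of the mean. -/
lemma abs_perturbed_rhs_sub_le {c G p b M ε t r v : ℝ} {U : ℂ} (hM : 0 < M) (hε0 : 0 < ε)
    (hε1 : ε < 1) (hc : c = p / G) (hG : 0 < G) (hGb : G ≤ b / 4) (hp : (1 - ε) * M ≤ p)
    (hr : 0 ≤ r) (hv : 0 ≤ v) (hU : ‖U‖ ≤ M) (hrU : |r - ‖U‖| ≤ ε * M)
    (hV : ‖U + (c : ℂ) * (-(Complex.I / 4) * hankel0 t)‖ ≤ (2 + ε) * M)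
    (hvV : |v - ‖U + (c : ℂ) * (-(Complex.I / 4) * hankel0 t)‖| ≤ ε * ((2 + ε) * M)) :
    |(2 / c * (v ^ 2 - r ^ 2) - c / 8 * ‖hankel0 t‖ ^ 2)
      - (besselY0 t * U.re - besselJ0 t * U.im)|
      ≤ b * (ε * ((2 + ε) * ((2 + ε) ^ 2 + 1)) * M / (2 * (1 - ε))) := by
  have h1ε : 0 < 1 - ε := by linarith
  have hp0 : 0 < p := (by positivity : 0 < (1 - ε) * M).trans_le hp
  have hc0 : 0 < c := by rw [hc]; positivity
  rw [← polarization hc0.ne']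
  set V := ‖U + (c : ℂ) * (-(Complex.I / 4) * hankel0 t)‖ with hVdef
  have e : 2 / c * (v ^ 2 - r ^ 2) - c / 8 * ‖hankel0 t‖ ^ 2
      - (2 / c * (V ^ 2 - ‖U‖ ^ 2) - c / 8 * ‖hankel0 t‖ ^ 2)
      = 2 / c * ((v ^ 2 - V ^ 2) - (r ^ 2 - ‖U‖ ^ 2)) := by ring
  rw [e, abs_mul, abs_of_pos (by positivity : 0 < 2 / c)]
  have h1 := abs_sq_sub_sq_le hv (norm_nonneg _) hV hvV
  have h2 := abs_sq_sub_sq_le hr (norm_nonneg _) hU hrU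
  have h3 : 2 / c ≤ b / 2 / ((1 - ε) * M) := by
    have hb : 2 * G ≤ b / 2 := by linarith
    rw [hc, div_div_eq_mul_div]
    gcongr
    linarith
  calc 2 / c * |(v ^ 2 - V ^ 2) - (r ^ 2 - ‖U‖ ^ 2)|
      ≤ b / 2 / ((1 - ε) * M) * (ε * ((2 + ε) * M) * (2 * ((2 + ε) * M) + ε * ((2 + ε) * M))
        + ε * M * (2 * M + ε * M)) := by
        refine mul_le_mul h3 ((abs_sub _ _).trans (add_le_add h1 h2)) (abs_nonneg _) ?_
        exact (by positivity : 0 ≤ 2 / c).trans h3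
    _ = _ := by field_simp

/-- The constant `3.6` of the determinant bound is small enough for `C_ε`; at `ε = 1` the two
numerators are `108` and `110`. -/
lemma stabConst_bound {ε : ℝ} (h0 : 0 < ε) (h1 : ε < 1) :
    3.6 * ((2 + ε) * ((2 + ε) ^ 2 + 1)) / (1 - ε) ≤ stabConst ε := by
  unfold stabConst
  have : 0 < 1 - ε := by linarith
  gcongr
  have h2 : ε ^ 2 ≤ 1 := pow_le_one₀ h0.le h1.le
  have h3 : ε ^ 3 ≤ ε := by nlinarith
  nlinarith

lemma det_matA_eq_zero {a τ k : ℝ} {m j : ℕ} {x : Plane} :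
    ∀ l, Jref a τ k m j l x = 0 → Yref a τ k m j l x = 0 → (matA a τ k m j x).det = 0 :=
  Fin.forall_fin_two.2 ⟨fun h h' => by rw [det_matA, h, h']; ring,
    fun h h' => by rw [det_matA, h, h']; ring⟩

/-- Pointwise form of the stability estimate, given bounds `B l` for the Hankel functions that are
dominated by the determinant. -/
lemma norm_recoveredMean_sub_le {a τ k : ℝ} {m j : ℕ} {B G : Fin 2 → ℝ} {p M ε : ℝ}
    {pu : Plane → ℝ} {pv : Fin 2 → Plane → ℝ} {x : Plane} {U : ℂ}
    (hM : 0 < M) (hε0 : 0 < ε) (hε1 : ε < 1) (hB0 : ∀ l, 0 < B l)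
    (hB : ∀ l, Jref a τ k m j l x ^ 2 + Yref a τ k m j l x ^ 2 ≤ B l ^ 2)
    (hdet : B 0 * B 1 ≤ 3.6 * |(matA a τ k m j x).det|)
    (hc : ∀ l, scaling a τ k m j pu l = p / G l) (hG : ∀ l, 0 < G l) (hGB : ∀ l, G l ≤ B l / 4)
    (hp : (1 - ε) * M ≤ p) (hpu0 : 0 ≤ pu x) (hpv0 : ∀ l, 0 ≤ pv l x)
    (hU : ‖U‖ ≤ M) (hpu : |pu x - ‖U‖| ≤ ε * M)
    (hV : ∀ l, ‖U + (scaling a τ k m j pu l : ℂ) * green k x (refPoint a τ k m j l)‖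
      ≤ (2 + ε) * M)
    (hpv : ∀ l, |pv l x - ‖U + (scaling a τ k m j pu l : ℂ) *
      green k x (refPoint a τ k m j l)‖| ≤ ε * ((2 + ε) * M)) :
    ‖recoveredMean a τ k m j pu pv x - U‖ ≤ ε * stabConst ε * M := by
  have hrhs : ∀ l, |rhs a τ k m j pu pv l x
      - (Yref a τ k m j l x * U.re - Jref a τ k m j l x * U.im)|
      ≤ B l * (ε * ((2 + ε) * ((2 + ε) ^ 2 + 1)) * M / (2 * (1 - ε))) := fun l =>
    abs_perturbed_rhs_sub_le hM hε0 hε1 (hc l) (hG l) (hGB l) hp hpu0 (hpv0 l) hU hpu (hV l) (hpv l)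
  have hBB : 0 < B 0 * B 1 := mul_pos (hB0 0) (hB0 1)
  rw [det_matA] at hdet
  have hD : 0 < |Jref a τ k m j 0 x * Yref a τ k m j 1 x
      - Jref a τ k m j 1 x * Yref a τ k m j 0 x| := by linarith
  refine (norm_cramer_sub_le (abs_pos.1 hD) (hrhs 0) (hrhs 1) (hB 0) (hB 1) (hB0 0).le
    (hB0 1).le).trans ?_
  set κ := ε * ((2 + ε) * ((2 + ε) ^ 2 + 1)) * M / (2 * (1 - ε)) with hκ
  have h1ε : 0 < 1 - ε := by linarith
  have hκ0 : 0 ≤ κ := by positivity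
  calc _ ≤ 2 * κ * 3.6 := by
        rw [div_le_iff₀ hD]
        nlinarith [mul_le_mul_of_nonneg_left hdet hκ0]
    _ = ε * (3.6 * ((2 + ε) * ((2 + ε) ^ 2 + 1)) / (1 - ε)) * M := by
        rw [hκ]; field_simp
    _ ≤ ε * stabConst ε * M := by
        gcongr
        exact stabConst_bound hε0 hε1

end PhaseRetrieval

end

open PhaseRetrieval

theorem theorem2p2
    -- probability space, white noise, random source `g + σ Ẇ` in the square `(-a, a)²`
    {Ω : Type*} [MeasurableSpace Ω] (P : MeasureTheory.Measure Ω)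
    [MeasureTheory.IsProbabilityMeasure P]
    (W : Lp ℝ 2 (volume : Measure PhaseRetrieval.Plane) →ₗ[ℝ] Lp ℝ 2 P)
    (hW : PhaseRetrieval.IsWhiteNoise P W)
    (a : ℝ) (ha : 0 < a)
    (g σ : PhaseRetrieval.Plane → ℝ)
    (hg : MemLp g 2 (volume.restrict (PhaseRetrieval.square a)))
    (hgc : HasCompactSupport g) (hgs : tsupport g ⊆ PhaseRetrieval.square a)
    (hσ : MemLp σ 4 (volume.restrict (PhaseRetrieval.square a)))
    (hσc : HasCompactSupport σ) (hσs : tsupport σ ⊆ PhaseRetrieval.square a)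
    (hσ0 : ∀ x, 0 ≤ σ x)
    -- parameters
    (τ : ℝ) (hτ : 6 ≤ τ) (m : ℕ) (hm : 10 ≤ m)
    (k : ℝ) (hk : k ∈ PhaseRetrieval.admissible a)
    (j : ℕ) (hj1 : 1 ≤ j) (hjm : j ≤ m)
    (R : ℝ) (hR : R = PhaseRetrieval.radius a τ k)
    -- the radiated field
    (u : PhaseRetrieval.Plane → Ω → ℂ)
    (hu : PhaseRetrieval.IsMildSolution P W a k g σ u)
    -- measured data `|E^ε(u)|`, `|E^ε(v_ℓ)|`, `E^ε(|u|²)` and their relative error bounds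
    (ε : ℝ) (hε0 : 0 < ε) (hε1 : ε < 1)
    (pu : PhaseRetrieval.Plane → ℝ) (pv : Fin 2 → PhaseRetrieval.Plane → ℝ)
    (qu : PhaseRetrieval.Plane → ℝ)
    (hpu0 : ∀ x, 0 ≤ pu x) (hpv0 : ∀ l x, 0 ≤ pv l x)
    (hpu : PhaseRetrieval.linf R m j (fun x => pu x - ‖PhaseRetrieval.mean P u x‖)
      ≤ ENNReal.ofReal ε * PhaseRetrieval.linf R m j (PhaseRetrieval.mean P u))
    (hpv : ∀ l : Fin 2,
      PhaseRetrieval.linf R m j (fun x => pv l x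
          - ‖PhaseRetrieval.mean P (PhaseRetrieval.vHat a τ k m j pu u l) x‖)
        ≤ ENNReal.ofReal ε * PhaseRetrieval.linf R m j
            (PhaseRetrieval.mean P (PhaseRetrieval.vHat a τ k m j pu u l)))
    (hqu : PhaseRetrieval.linf R m j (fun x => qu x - PhaseRetrieval.meanSq P u x)
      ≤ ENNReal.ofReal ε * PhaseRetrieval.linf R m j (PhaseRetrieval.meanSq P u)) :
    -- the linear system is uniquely solvable on the arc, and its solution is stable
    (∀ x ∈ PhaseRetrieval.arc R m j, (PhaseRetrieval.matA a τ k m j x).det ≠ 0) ∧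
    PhaseRetrieval.linf R m j (fun x =>
        PhaseRetrieval.recoveredMean a τ k m j pu pv x - PhaseRetrieval.mean P u x)
      ≤ ENNReal.ofReal (ε * PhaseRetrieval.stabConst ε)
          * PhaseRetrieval.linf R m j (PhaseRetrieval.mean P u) := by
  subst hR
  obtain ⟨B, hB0, hB⟩ := exists_amplitude_bounds (τ := τ) ha hτ hm hk j
  have hBB : 0 < B 0 * B 1 := mul_pos (hB0 0) (hB0 1)
  have hdet : ∀ x ∈ arc (radius a τ k) m j,
      (matA a τ k m j x).det ≠ 0 := by
    intro x hx h0
    have := (hB x hx).2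
    rw [h0, abs_zero] at this
    linarith
  refine ⟨hdet, ?_⟩
  have hstab : 0 < ε * stabConst ε := by
    have h1ε : 0 < 1 - ε := by linarith
    unfold stabConst
    positivity
  have hRpos : 0 < radius a τ k := by
    unfold radius
    split_ifs <;> nlinarith
  have hne := arcMeasure_ne_zero hRpos (by omega : 0 < m) j
  have hmem := ae_mem_arc (radius a τ k) m j
  set R := radius a τ k with hR
  -- where the norm of the mean is infinite, so is the right-hand side
  by_cases hMtop : linf R m j (mean P u) = ∞
  · rw [hMtop, ENNReal.mul_top (ENNReal.ofReal_pos.2 hstab).ne']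
    exact le_top
  obtain ⟨M, hMdef⟩ : ∃ M, M = (linf R m j (mean P u)).toReal :=
    ⟨_, rfl⟩
  have hM0 : 0 ≤ M := hMdef ▸ ENNReal.toReal_nonneg
  have hMeq : linf R m j (mean P u) = ENNReal.ofReal M := by
    rw [hMdef, ENNReal.ofReal_toReal hMtop]
  have hU := ae_norm_le_toReal_linf hMtop
  rw [← hMdef] at hU
  rw [hMeq, ← ENNReal.ofReal_mul hε0.le] at hpu
  have hpu' := ae_norm_le_of_linf_le (by positivity) hpu
  rw [hMeq, ← ENNReal.ofReal_mul hstab.le]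
  refine linf_le_of_ae_norm_le ?_
  -- the size `p` of the measured modulus of the mean is comparable with `M`
  have hpu_le : ∀ᵐ x ∂arcMeasure R m j, ‖pu x‖ ≤ (1 + ε) * M := by
    filter_upwards [hU, hpu'] with x h1 h2
    rw [Real.norm_eq_abs] at h2 ⊢
    rw [abs_of_nonneg (hpu0 x)]
    linarith [(abs_le.1 h2).2]
  obtain ⟨p, hp⟩ : ∃ p, p = (linf R m j pu).toReal := ⟨_, rfl⟩
  have hp0 : 0 ≤ p := hp ▸ ENNReal.toReal_nonneg
  have hp_le : p ≤ (1 + ε) * M := hp ▸ toReal_linf_le (by positivity) hpu_le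
  have hp_ge : (1 - ε) * M ≤ p := by
    have : M ≤ p + ε * M := by
      rw [hMdef]
      refine toReal_linf_le (by rw [← hMdef]; positivity) ?_
      rw [← hMdef]
      filter_upwards [ae_norm_le_toReal_linf (linf_ne_top hpu_le),
        hpu'] with x h1 h2
      rw [← hp, Real.norm_eq_abs, abs_of_nonneg (hpu0 x)] at h1
      rw [Real.norm_eq_abs] at h2
      linarith [(abs_le.1 h2).1]
    linarith
  -- the norms `G l` of the reference waves
  obtain ⟨G, hGdef⟩ : ∃ G : Fin 2 → ℝ, ∀ l, G l = (linf R m j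
      fun x => green k x (refPoint a τ k m j l)).toReal :=
    ⟨_, fun _ => rfl⟩
  have hgreen : ∀ l, ∀ᵐ x ∂arcMeasure R m j,
      ‖green k x (refPoint a τ k m j l)‖ ≤ B l / 4 := by
    intro l
    filter_upwards [hmem] with x hx
    rw [norm_green]
    have : ‖hankel0 (k * refDist a τ k m j l x)‖ ≤ B l := by
      refine le_of_sq_le_sq ?_ (hB0 l).le
      rw [norm_hankel0_sq]
      exact (hB x hx).1 l
    linarith
  have hG_le : ∀ l, G l ≤ B l / 4 := fun l => hGdef l ▸
    toReal_linf_le (by linarith [hB0 l]) (hgreen l)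
  have hgreenG : ∀ l, ∀ᵐ x ∂arcMeasure R m j,
      ‖green k x (refPoint a τ k m j l)‖ ≤ G l := fun l => hGdef l ▸
    ae_norm_le_toReal_linf (linf_ne_top (hgreen l))
  have hG : ∀ l, 0 < G l := by
    -- a reference wave vanishing at a point of the arc would annihilate a row of the system
    intro l
    have : (ae (arcMeasure R m j)).NeBot := ae_neBot.2 hne
    obtain ⟨x, hx, hxl⟩ := (hmem.and (hgreenG l)).exists
    refine lt_of_lt_of_le ?_ hxl
    rw [norm_green]
    have hpos : 0 < ‖hankel0 (k * refDist a τ k m j l x)‖ := by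
      refine norm_pos_iff.2 fun h0 => hdet x hx ?_
      have hsq := norm_hankel0_sq (k * refDist a τ k m j l x)
      rw [h0, norm_zero] at hsq
      have hJ : Jref a τ k m j l x = 0 := by
        unfold Jref; nlinarith [sq_nonneg (besselY0
          (k * refDist a τ k m j l x))]
      have hY : Yref a τ k m j l x = 0 := by
        unfold Yref; nlinarith [sq_nonneg (besselJ0
          (k * refDist a τ k m j l x))]
      exact det_matA_eq_zero l hJ hY
    linarith
  have hc : ∀ l, scaling a τ k m j pu l = p / G l := by
    intro l
    rw [scaling, hp, hGdef, hR]
  have hmean : ∀ l x, mean P (vHat a τ k m j pu u l) x =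
      mean P u x + (scaling a τ k m j pu l : ℂ) *
        green k x (refPoint a τ k m j l) :=
    fun l x => mean_vHat (hu.integrable x)
  have hV : ∀ l, ∀ᵐ x ∂arcMeasure R m j,
      ‖mean P (vHat a τ k m j pu u l) x‖ ≤ (2 + ε) * M := by
    intro l
    filter_upwards [hU, hgreenG l] with x h1 h2
    rw [hmean, hc]
    have h3 : ‖((p / G l : ℝ) : ℂ) *
        green k x (refPoint a τ k m j l)‖ ≤ p := by
      rw [norm_mul, Complex.norm_real, Real.norm_eq_abs,
        abs_of_nonneg (div_nonneg hp0 (hG l).le)]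
      calc p / G l * _ ≤ p / G l * G l := by gcongr; exact div_nonneg hp0 (hG l).le
        _ = p := div_mul_cancel₀ _ (hG l).ne'
    linarith [norm_add_le (mean P u x) (((p / G l : ℝ) : ℂ) *
        green k x (refPoint a τ k m j l))]
  have hpv' : ∀ l, ∀ᵐ x ∂arcMeasure R m j, |pv l x
      - ‖mean P (vHat a τ k m j pu u l) x‖|
      ≤ ε * ((2 + ε) * M) := by
    intro l
    refine ae_norm_le_of_linf_le (by positivity) ((hpv l).trans ?_)
    rw [ENNReal.ofReal_mul hε0.le]
    gcongr
    exact linf_le_of_ae_norm_le (hV l)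
  rcases hM0.eq_or_lt with hMz | hMpos
  · -- a vanishing mean: the scaling factors vanish, and so do the right-hand sides, as `2 / 0 = 0`
    have hpz : p = 0 := by
      rw [← hMz] at hp_le
      linarith
    filter_upwards [hU] with x h1
    have hUz : mean P u x = 0 := norm_le_zero_iff.1 (by rw [hMz]; exact h1)
    have hrhs : rhs a τ k m j pu pv = 0 := by
      funext l y
      simp [rhs, hc, hpz]
    simp [hUz, ← hMz, recoveredMean, hrhs, matAR,
      matAI]
  · filter_upwards [hU, hpu', hmem, hV 0, hV 1, hpv' 0, hpv' 1] with x h1 h2 h3 h4 h5 h6 h7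
    rw [hmean] at h4 h5 h6 h7
    exact norm_recoveredMean_sub_le hMpos hε0 hε1 hB0 (hB x h3).1 (hB x h3).2 hc hG
      hG_le hp_ge (hpu0 x) (fun l => hpv0 l x) h1 h2 (Fin.forall_fin_two.2 ⟨h4, h5⟩)
      (Fin.forall_fin_two.2 ⟨h6, h7⟩)
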